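/- For $z\in\mathbb{C}$ let $\mathrm{erfc}(z)=\frac{2}{\sqrt\pi}\int_z^\infty e^{-t^2}\,dt$ (integration along $\{z+t:t\ge 0\}$) and let $w(z)=e^{-z^2}\,\mathrm{erfc}(-\mathrm{i}z)$ be the Faddeeva function. Let $N\in\{0,1,2,\dots\}$, $h:=\sqrt{\pi/(N+1)}$, $\alpha\in\{0,\tfrac12\}$, $s_k:=(k+\alpha)h$, and $$f_z(t):=\frac{\mathrm{i}\,z\,e^{-t^2}}{\pi(z^2-t^2)},\qquad I^{N}_{h,\alpha}[f_z]:=\begin{cases} h f_z(0)+2h\sum_{k=1}^{N} f_z(s_k), & \alpha=0,\\ 2h\sum_{k=0}^{N} f_z(s_k), & \alpha=\tfrac12,\end{cases}$$ $$I^{*,N}_{h,\alpha}[f_z]:=I^{N}_{h,\alpha}[f_z]+\frac{2e^{-z^2}}{1-e^{-2\mathrm{i}\pi(\alpha+z/h)}},$$ where $I^{*,N}_{h,\alpha}[f_z]$ is regarded as a meromorphic function of $z$ with its removable singularities removed. Let $$C_1:=\frac{2(2e+\sqrt\pi)}{e^{\pi}\sqrt{e\pi}\,\bigl(1-\exp(-2\pi+\sqrt{2\pi})\bigr)}+\frac{10\sqrt2\,(1+2\pi)}{e^{\pi}\pi^2},$$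 $$C_2:=\frac{2\sqrt2\,(1+\sqrt\pi)(2e+\sqrt\pi)}{e^{\pi}\sqrt{e}\,\bigl(1-\exp(-2\pi+\sqrt{2\pi})\bigr)}+\frac{10(1+2\pi)(2\pi+\sqrt2)}{e^{\pi}\pi^2}.$$ Theorem. Let $z=x+\mathrm{i}y$ with $x,y\in\mathbb{R}$. (i) If either $\pi/h\ge y\ge x\ge 0$, or $0\le y\le x$ and $|z-s_k|\ge h/4$ for all integers $k\ge N+1$, then $I^{*,N}_{h,\alpha}[f_z]$ is well defined at $z$ (as the limit of its defining expression), $w(z)\ne0$, and $$|w(z)-I^{*,N}_{h,\alpha}[f_z]|\le C_1e^{-\pi N},\qquad \frac{|w(z)-I^{*,N}_{h,\alpha}[f_z]|}{|w(z)|}\le C_2\sqrt{N+1}\,e^{-\pi N}.$$ (ii) If $x\ge0$ and $y\ge\max(x,\pi/h)$, then $w(z)\ne0$ and $$|w(z)-I^{N}_{h,\alpha}[f_z]|\le C_1e^{-\pi N},\qquad \frac{|w(z)-I^{N}_{h,\alpha}[f_z]|}{|w(z)|}\le C_2\sqrt{N+1}\,e^{-\pi N}.$$ -/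

import Mathlib

noncomputable section

namespace Faddeeva

/-- The complementary error function `erfc z = (2/√π) ∫_z^∞ exp (-t²) dt` of a complex variable;
the path of integration is the horizontal ray `z + t`, `t > 0`. -/
def erfc (z : ℂ) : ℂ :=
  ((2 / √Real.pi : ℝ) : ℂ) * ∫ t in Set.Ioi (0 : ℝ), Complex.exp (-(z + (t : ℂ)) ^ 2)

/-- The Faddeeva function `w z = exp (-z²) erfc (-i z)`. -/
def w (z : ℂ) : ℂ := Complex.exp (-z ^ 2) * erfc (-(Complex.I * z))

/-- The integrand `f_z(t) = exp (-t²) · i z / (π (z² - t²))`. -/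
def integrand (z : ℂ) (t : ℝ) : ℂ :=
  Complex.exp (-(t : ℂ) ^ 2) * (Complex.I * z / ((Real.pi : ℂ) * (z ^ 2 - (t : ℂ) ^ 2)))

/-- The nodes `s_k = (k + α) h`. -/
def node (h α : ℝ) (k : ℕ) : ℝ := ((k : ℝ) + α) * h

open Classical in
/-- The truncated trapezoidal rule (`α = 0`) and truncated midpoint rule (`α = 1/2`), of step `h`,
applied to an even function `f`:
`h f(0) + 2h ∑_{k=1}^N f(k h)` and `2h ∑_{k=0}^N f((k + 1/2) h)` respectively.
Only the values `0` and `1/2` of `α` are used. -/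
def truncRule (h α : ℝ) (N : ℕ) (f : ℝ → ℂ) : ℂ :=
  if α = 0 then (h : ℂ) * f 0 + 2 * (h : ℂ) * ∑ k ∈ Finset.Icc 1 N, f (node h α k)
  else 2 * (h : ℂ) * ∑ k ∈ Finset.range (N + 1), f (node h α k)

/-- The correction term `C_{h,α}[f_z] = 2 exp (-z²) / (1 - exp (-2 i π (α + z/h)))`. -/
def correction (h α : ℝ) (z : ℂ) : ℂ :=
  2 * Complex.exp (-z ^ 2) /
    (1 - Complex.exp (-(2 * Complex.I * (Real.pi : ℂ) * ((α : ℂ) + z / (h : ℂ)))))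

/-- The unmodified truncated rule `I^N_{h,α}[f_z]`, as a function of `z`. -/
def truncApprox (h α : ℝ) (N : ℕ) (z : ℂ) : ℂ := truncRule h α N (integrand z)

/-- The expression `I^N_{h,α}[f_z] + C_{h,α}[f_z]`, away from its singularities in `z`. -/
def rawModApprox (h α : ℝ) (N : ℕ) (z : ℂ) : ℂ := truncApprox h α N z + correction h α z

/-- The modified truncated rule `I^{*,N}_{h,α}[f_z] = I^N_{h,α}[f_z] + C_{h,α}[f_z]`, as a
meromorphic function of `z` whose removable singularities have been removed: the value at `z` is
the limit of the defining expression at `z`. -/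
def modApprox (h α : ℝ) (N : ℕ) (z : ℂ) : ℂ :=
  Filter.limUnder (nhdsWithin z {z}ᶜ) (rawModApprox h α N)

/-- The step size `h = √(π / (N + 1))`. -/
def step (N : ℕ) : ℝ := √(Real.pi / ((N : ℝ) + 1))

/-- The constant in the absolute error bound. -/
def C₁ : ℝ :=
  2 * (2 * Real.exp 1 + √Real.pi) /
      (Real.exp Real.pi * √(Real.exp 1 * Real.pi) *
        (1 - Real.exp (-2 * Real.pi + √(2 * Real.pi)))) +
    10 * √2 * (1 + 2 * Real.pi) / (Real.exp Real.pi * Real.pi ^ 2)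

/-- The constant in the relative error bound. -/
def C₂ : ℝ :=
  2 * √2 * (1 + √Real.pi) * (2 * Real.exp 1 + √Real.pi) /
      (Real.exp Real.pi * √(Real.exp 1) *
        (1 - Real.exp (-2 * Real.pi + √(2 * Real.pi)))) +
    10 * (1 + 2 * Real.pi) * (2 * Real.pi + √2) / (Real.exp Real.pi * Real.pi ^ 2)

end Faddeeva

end

namespace Faddeeva

open Real Set Filter Topology MeasureTheory

noncomputable section

/-! Write `b = π / h`. For `Im z > 0` the function `w` is `2 / √π` times the half-line integral of
`exp (2 i z t - t²)`, and each term `exp (-s²) / (z - s)` of the full grid sum is likewise a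
half-line Laplace integral. Poisson summation of the Gaussian inside the integral turns the infinite
quadrature sum into the dual series `∑ₙ phase · exp (-(n b)²) · w (z + i n b)` (`tsum_cauchyTerm`).
Its term `n = 0` is `w z`, so the error consists of the dropped quadrature tail and the dual terms
with `n ≠ 0`.

The terms `n > 0` are small because `w` is bounded by 1 in the upper half-plane. For `n < 0` the
reflection `w ζ + w (-ζ) = 2 exp (-ζ²)` splits off a geometric series whose sum is exactly minus the
correction, and the reflected remainder is small when `Im z ≤ b` (`tsum_dualTerm_neg`). When `Im z ≥
b` the terms `n < 0` are already small, and for `Im z ≤ Re z` so is the correction.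

The step balances the two sources of error: the tail begins no earlier than `(N + 1) h = b`, so
everything has size `exp (-b²) = exp (-π) exp (-π N)`. Each piece is also estimated with the weight
`1 + √π |z|`; together with `1 ≤ 2 (1 + √π |z|) |w z|` in the first quadrant (`one_le_mul_norm_w`)
this gives the relative bound. The residues of rule and correction cancel at retained nodes, and the
real axis is reached as a limit from above. -/

/-! ### Half-line Gaussian integrals. -/

/-- The integrand of the half-line representation of the Faddeeva function. -/
def kernel (z : ℂ) (t : ℝ) : ℂ := Complex.exp (2 * Complex.I * z * t - (t : ℂ) ^ 2)

/-- The modulus of `kernel z`, as a function of `y = Im z`. -/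
def realKernel (y t : ℝ) : ℝ := exp (-2 * y * t - t ^ 2)

/-- The integral of `realKernel y` over the positive half-line. -/
def halfGauss (y : ℝ) : ℝ := ∫ t in Ioi (0 : ℝ), realKernel y t

theorem norm_kernel (z : ℂ) (t : ℝ) : ‖kernel z t‖ = realKernel z.im t := by
  rw [kernel, realKernel, Complex.norm_exp]
  congr 1
  simp [pow_two]

theorem continuous_kernel (z : ℂ) : Continuous (kernel z) := by
  unfold kernel; fun_prop

theorem continuous_realKernel (y : ℝ) : Continuous (realKernel y) := by
  unfold realKernel; fun_prop

theorem realKernel_pos (y t : ℝ) : 0 < realKernel y t := exp_pos _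

theorem realKernel_le (y t : ℝ) : realKernel y t ≤ exp (2 * y ^ 2) * exp (-(1 / 2) * t ^ 2) := by
  rw [realKernel, ← exp_add]
  exact exp_le_exp.2 (by nlinarith [sq_nonneg (2 * y + t)])

theorem realKernel_anti {y y' t : ℝ} (h : y ≤ y') (ht : 0 ≤ t) :
    realKernel y' t ≤ realKernel y t :=
  exp_le_exp.2 (by nlinarith [mul_le_mul_of_nonneg_right h ht])

theorem integrable_realKernel (y : ℝ) : Integrable (realKernel y) := by
  refine ((integrable_exp_neg_mul_sq (b := 1 / 2) (by norm_num)).const_mul (exp (2 * y ^ 2))).mono'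
    (continuous_realKernel y).aestronglyMeasurable (.of_forall fun t => ?_)
  rw [norm_of_nonneg (realKernel_pos y t).le]
  exact realKernel_le y t

theorem integrable_mul_realKernel (y : ℝ) : Integrable fun t => 2 * t * realKernel y t := by
  refine ((integrable_mul_exp_neg_mul_sq (b := 1 / 2) (by norm_num)).norm.const_mul
    (2 * exp (2 * y ^ 2))).mono'
    (by have := continuous_realKernel y; fun_prop) (.of_forall fun t => ?_)
  rw [norm_mul, norm_mul, norm_of_nonneg (realKernel_pos y t).le, norm_mul,
    norm_of_nonneg (exp_pos _).le]
  have := realKernel_le y t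
  have h2 : ‖(2 : ℝ)‖ = 2 := by norm_num
  rw [h2]
  nlinarith [mul_le_mul_of_nonneg_left this (norm_nonneg t)]

theorem integrable_kernel (z : ℂ) : Integrable (kernel z) :=
  (integrable_realKernel z.im).mono' (continuous_kernel z).aestronglyMeasurable
    (.of_forall fun t => (norm_kernel z t).le)

theorem norm_two_mul_kernel (z : ℂ) {t : ℝ} (ht : 0 ≤ t) :
    ‖2 * (t : ℂ) * kernel z t‖ = 2 * t * realKernel z.im t := by
  rw [norm_mul, norm_kernel]; simp [abs_of_nonneg ht]

theorem integrable_mul_kernel (z : ℂ) : Integrable fun t : ℝ => 2 * (t : ℂ) * kernel z t := by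
  refine (integrable_mul_realKernel z.im).norm.mono'
    (by have := continuous_kernel z; fun_prop) (.of_forall fun t => ?_)
  rw [norm_mul, norm_mul, norm_kernel, norm_mul, norm_mul,
    norm_of_nonneg (realKernel_pos z.im t).le]
  simp

theorem tendsto_realKernel (y : ℝ) : Tendsto (realKernel y) atTop (𝓝 0) := by
  have h : Tendsto (fun t : ℝ => exp (2 * y ^ 2) * exp (-(1 / 2) * t ^ 2)) atTop
      (𝓝 (exp (2 * y ^ 2) * 0)) := by
    refine (tendsto_exp_atBot.comp ?_).const_mul _
    exact (tendsto_pow_atTop two_ne_zero).const_mul_atTop_of_neg (by norm_num)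
  rw [mul_zero] at h
  exact squeeze_zero (fun t => (realKernel_pos y t).le) (realKernel_le y) h

theorem w_eq_integral (z : ℂ) : w z = ((2 / √π : ℝ) : ℂ) * ∫ t in Ioi (0 : ℝ), kernel z t := by
  rw [w, erfc, mul_left_comm, ← integral_const_mul]
  congr 2
  ext t
  rw [kernel, ← Complex.exp_add]
  congr 1
  linear_combination -z ^ 2 * Complex.I_sq

theorem hasDerivAt_kernel (z : ℂ) (t : ℝ) :
    HasDerivAt (kernel z) ((2 * Complex.I * z - 2 * t) * kernel z t) t := by
  have h1 : HasDerivAt (fun t : ℝ => 2 * Complex.I * z * (t : ℂ) - (t : ℂ) ^ 2)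
      (2 * Complex.I * z - 2 * t) t := by
    have h0 := (hasDerivAt_id t).ofReal_comp
    have := (h0.const_mul (2 * Complex.I * z)).fun_sub (h0.fun_pow 2)
    simpa using this
  change HasDerivAt (fun t : ℝ => Complex.exp _) _ t
  convert h1.cexp using 1
  rw [kernel, mul_comm]

/-- Integrate the derivative of `kernel z`, which starts at 1 and vanishes at infinity. This is the
source of the `1 / |z|` behaviour of `w`. -/
theorem integral_kernel_by_parts (z : ℂ) :
    2 * Complex.I * z * (∫ t in Ioi (0 : ℝ), kernel z t)
      = -1 + ∫ t in Ioi (0 : ℝ), 2 * (t : ℂ) * kernel z t := by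
  have hi := (integrable_kernel z).integrableOn (s := Ioi 0)
  have hi' := (integrable_mul_kernel z).integrableOn (s := Ioi 0)
  have h := integral_Ioi_of_hasDerivAt_of_tendsto' (a := 0) (m := 0)
    (fun t _ => hasDerivAt_kernel z t)
    (by simp only [sub_mul]; exact (hi.const_mul _).sub hi')
    (tendsto_zero_iff_norm_tendsto_zero.2
      (by simpa only [norm_kernel] using tendsto_realKernel z.im))
  simp only [sub_mul] at h
  rw [integral_sub (hi.const_mul _) hi', integral_const_mul] at h
  have h0 : kernel z 0 = 1 := by simp [kernel]
  rw [h0] at h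
  linear_combination h

theorem kernel_ofReal_mul_I (y t : ℝ) : kernel (y * Complex.I) t = (realKernel y t : ℂ) := by
  rw [kernel, realKernel, Complex.ofReal_exp]
  congr 1
  push_cast
  linear_combination 2 * (y : ℂ) * t * Complex.I_sq

theorem halfGauss_by_parts (y : ℝ) :
    2 * y * halfGauss y = 1 - ∫ t in Ioi (0 : ℝ), 2 * t * realKernel y t := by
  have h := integral_kernel_by_parts (y * Complex.I)
  have h2 : ∀ t : ℝ, 2 * (t : ℂ) * (realKernel y t : ℂ) = ((2 * t * realKernel y t : ℝ) : ℂ) :=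
    fun t => by push_cast; rfl
  simp only [kernel_ofReal_mul_I, h2] at h
  rw [integral_complex_ofReal, integral_complex_ofReal] at h
  have h3 : (((2 * y * halfGauss y : ℝ)) : ℂ)
      = ((1 - ∫ t in Ioi (0 : ℝ), 2 * t * realKernel y t : ℝ) : ℂ) := by
    unfold halfGauss
    push_cast at h ⊢
    linear_combination -h + 2 * (y : ℂ) * (∫ t in Ioi (0 : ℝ), realKernel y t : ℝ) * Complex.I_sq
  exact_mod_cast h3

theorem halfGauss_anti {y y' : ℝ} (h : y ≤ y') : halfGauss y' ≤ halfGauss y :=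
  setIntegral_mono_on (integrable_realKernel _).integrableOn (integrable_realKernel _).integrableOn
    measurableSet_Ioi fun _ ht => realKernel_anti h (le_of_lt ht)

theorem halfGauss_zero : halfGauss 0 = √π / 2 := by
  have := integral_gaussian_Ioi 1
  simpa [halfGauss, realKernel] using this

theorem halfGauss_nonneg (y : ℝ) : 0 ≤ halfGauss y :=
  integral_nonneg fun t => (realKernel_pos y t).le

theorem integral_realKernel (y : ℝ) : ∫ t, realKernel y t = √π * exp (y ^ 2) := by
  have h : ∀ t, realKernel y t = exp (y ^ 2) * exp (-1 * (t + y) ^ 2) := fun t => by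
    rw [realKernel, ← exp_add]; congr 1; ring
  simp only [h]
  rw [integral_const_mul, integral_add_right_eq_self (fun t => exp (-1 * t ^ 2)),
    integral_gaussian]
  simp [mul_comm]

theorem halfGauss_le (y : ℝ) : halfGauss y ≤ √π * exp (y ^ 2) := by
  rw [← integral_realKernel]
  exact setIntegral_le_integral (integrable_realKernel y)
    (.of_forall fun t => (realKernel_pos y t).le)

/-! ### Upper bounds for the Faddeeva function. -/

theorem norm_w_le_halfGauss (z : ℂ) : ‖w z‖ ≤ 2 / √π * halfGauss z.im := by
  rw [w_eq_integral, norm_mul, Complex.norm_real, norm_of_nonneg (by positivity)]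
  gcongr
  refine (norm_integral_le_integral_norm _).trans_eq ?_
  simp only [norm_kernel, halfGauss]

theorem norm_w_le_one {z : ℂ} (hz : 0 ≤ z.im) : ‖w z‖ ≤ 1 := by
  refine (norm_w_le_halfGauss z).trans ?_
  have h := halfGauss_anti hz
  rw [halfGauss_zero] at h
  have hp : 0 < √π := by positivity
  calc 2 / √π * halfGauss z.im ≤ 2 / √π * (√π / 2) := by gcongr
    _ = 1 := by field_simp

theorem norm_w_le {z : ℂ} {c : ℝ} (hz : -c ≤ z.im) : ‖w z‖ ≤ 2 * exp (c ^ 2) := by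
  refine (norm_w_le_halfGauss z).trans ?_
  have h := (halfGauss_anti hz).trans (halfGauss_le _)
  rw [neg_sq] at h
  have hp : 0 < √π := by positivity
  calc 2 / √π * halfGauss z.im ≤ 2 / √π * (√π * exp (c ^ 2)) := by gcongr
    _ = 2 * exp (c ^ 2) := by field_simp

theorem norm_integral_mul_kernel_le (z : ℂ) :
    ‖∫ t in Ioi (0 : ℝ), 2 * (t : ℂ) * kernel z t‖ ≤ 1 - 2 * z.im * halfGauss z.im := by
  rw [halfGauss_by_parts, sub_sub_cancel]
  refine (norm_integral_le_integral_norm _).trans_eq ?_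
  exact setIntegral_congr_fun measurableSet_Ioi fun t ht =>
    norm_two_mul_kernel z (le_of_lt ht)

/-- Integration by parts makes both sides first moments of `realKernel`, which decreases pointwise
in `y`. -/
theorem integral_mul_realKernel_anti {y y' : ℝ} (h : y ≤ y') :
    1 - 2 * y' * halfGauss y' ≤ 1 - 2 * y * halfGauss y := by
  rw [halfGauss_by_parts, halfGauss_by_parts, sub_sub_cancel, sub_sub_cancel]
  exact setIntegral_mono_on (integrable_mul_realKernel _).integrableOn
    (integrable_mul_realKernel _).integrableOn measurableSet_Ioi fun t ht =>
      mul_le_mul_of_nonneg_left (realKernel_anti h (le_of_lt ht)) (by have : 0 < t := ht; positivity)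

theorem sqrt_pi_mul_w (z : ℂ) :
    ((√π : ℝ) : ℂ) * (Complex.I * z * w z)
      = -1 + ∫ t in Ioi (0 : ℝ), 2 * (t : ℂ) * kernel z t := by
  rw [← integral_kernel_by_parts, w_eq_integral]
  have : ((√π : ℝ) : ℂ) ≠ 0 := by exact_mod_cast (by positivity : √π ≠ 0)
  push_cast
  field_simp

theorem norm_sqrt_pi_mul_w (z : ℂ) :
    √π * ‖z‖ * ‖w z‖ = ‖-1 + ∫ t in Ioi (0 : ℝ), 2 * (t : ℂ) * kernel z t‖ := by
  rw [← sqrt_pi_mul_w, norm_mul, Complex.norm_real, norm_of_nonneg (by positivity), norm_mul,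
    norm_mul, Complex.norm_I]
  ring

/-- Arguments below the real axis are allowed because the dual terms of negative index reach there
when `Im z ≥ b`. -/
theorem sqrt_pi_mul_norm_w_le {z : ℂ} {c : ℝ} (hc : 0 ≤ c) (hz : -c ≤ z.im) :
    √π * ‖z‖ * ‖w z‖ ≤ 2 + 2 * c * √π * exp (c ^ 2) := by
  rw [norm_sqrt_pi_mul_w]
  refine (norm_add_le _ _).trans ?_
  have h1 := (norm_integral_mul_kernel_le z).trans (integral_mul_realKernel_anti hz)
  have h2 := halfGauss_le (-c)
  rw [neg_sq] at h2
  rw [norm_neg, norm_one]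
  nlinarith [mul_le_mul_of_nonneg_left h2 hc]

theorem mul_halfGauss_le_norm_w (z : ℂ) :
    2 * z.im * halfGauss z.im ≤ √π * ‖z‖ * ‖w z‖ := by
  rw [norm_sqrt_pi_mul_w]
  have h := norm_integral_mul_kernel_le z
  have h2 := norm_sub_le (-1 + ∫ t in Ioi (0 : ℝ), 2 * (t : ℂ) * kernel z t)
    (∫ t in Ioi (0 : ℝ), 2 * (t : ℂ) * kernel z t)
  rw [add_sub_cancel_right, norm_neg, norm_one] at h2
  linarith

/-! ### Differential equation and reflection formula for `w`. -/

theorem hasDerivAt_w (z : ℂ) :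
    HasDerivAt w (-2 * z * w z + 2 * Complex.I / ((√π : ℝ) : ℂ)) z := by
  have hp : ((√π : ℝ) : ℂ) ≠ 0 := by exact_mod_cast (by positivity : √π ≠ 0)
  have key := (hasDerivAt_integral_of_dominated_loc_of_deriv_le
    (μ := volume.restrict (Ioi (0 : ℝ))) (F := kernel)
    (F' := fun ζ t => Complex.I * (2 * (t : ℂ) * kernel ζ t))
    (bound := fun t => 2 * t * realKernel (z.im - 1) t)
    (Metric.ball_mem_nhds z one_pos)
    (.of_forall fun ζ => (continuous_kernel ζ).aestronglyMeasurable)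
    (integrable_kernel z).integrableOn
    ((integrable_mul_kernel z).integrableOn.const_mul _).aestronglyMeasurable
    ((ae_restrict_iff' measurableSet_Ioi).2 (.of_forall fun t ht ζ hζ => ?_))
    (integrable_mul_realKernel _).integrableOn
    (.of_forall fun t ζ _ => ?_)).2
  · rw [integral_const_mul] at key
    have h2 := key.const_mul ((2 / √π : ℝ) : ℂ)
    have h3 : w = fun ζ => ((2 / √π : ℝ) : ℂ) * ∫ t in Ioi (0 : ℝ), kernel ζ t :=
      funext w_eq_integral
    rw [h3]
    refine h2.congr_deriv ?_
    have h4 := integral_kernel_by_parts z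
    push_cast
    field_simp
    linear_combination -Complex.I * h4 + 2 * z * (∫ t in Ioi (0 : ℝ), kernel z t) * Complex.I_sq
  · have ht : 0 < t := ht
    rw [norm_mul, Complex.norm_I, one_mul, norm_two_mul_kernel ζ ht.le]
    refine mul_le_mul_of_nonneg_left (realKernel_anti ?_ ht.le) (by positivity)
    have h1 : ‖ζ - z‖ < 1 := by simpa [dist_eq_norm] using hζ
    have h2 := (Complex.abs_im_le_norm (ζ - z)).trans h1.le
    rw [Complex.sub_im] at h2
    linarith [(abs_le.1 h2).1]
  · have h1 : HasDerivAt (fun ζ : ℂ => 2 * Complex.I * ζ * (t : ℂ) - (t : ℂ) ^ 2)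
        (2 * Complex.I * t) ζ := by
      have := (((hasDerivAt_id ζ).const_mul (2 * Complex.I)).mul_const (t : ℂ)).sub_const
        ((t : ℂ) ^ 2)
      simpa using this
    change HasDerivAt (fun ζ : ℂ => Complex.exp _) _ ζ
    refine h1.cexp.congr_deriv ?_
    rw [kernel]; ring

theorem continuous_w : Continuous w :=
  continuous_iff_continuousAt.2 fun z => (hasDerivAt_w z).continuousAt

/-- The two half-line integrals join into the Fourier integral of a Gaussian over the whole line. -/
theorem w_add_w_neg (z : ℂ) : w z + w (-z) = 2 * Complex.exp (-z ^ 2) := by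
  have h1 : ∫ t in Ioi (0 : ℝ), kernel (-z) t = ∫ t in Iic (0 : ℝ), kernel z t := by
    have := integral_comp_neg_Iic (0 : ℝ) (kernel (-z))
    rw [neg_zero] at this
    rw [← this]
    congr 1
    ext t
    rw [kernel, kernel]
    congr 1
    push_cast
    ring
  have h2 := integral_cexp_quadratic (b := -1) (by norm_num) (2 * Complex.I * z) 0
  have h3 : ∀ t : ℝ, Complex.exp (-1 * (t : ℂ) ^ 2 + 2 * Complex.I * z * t + 0) = kernel z t :=
    fun t => by rw [kernel]; congr 1; ring
  simp only [h3] at h2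
  rw [w_eq_integral, w_eq_integral, h1, ← mul_add, add_comm,
    intervalIntegral.integral_Iic_add_Ioi (integrable_kernel z).integrableOn
      (integrable_kernel z).integrableOn, h2]
  have hp : ((√π : ℝ) : ℂ) ≠ 0 := by exact_mod_cast (by positivity : √π ≠ 0)
  have h4 : ((π : ℂ) / - -1) ^ (1 / 2 : ℂ) = ((√π : ℝ) : ℂ) := by
    rw [Real.sqrt_eq_rpow, Complex.ofReal_cpow pi_pos.le]
    norm_num
  have h5 : (0 : ℂ) - (2 * Complex.I * z) ^ 2 / (4 * -1) = -z ^ 2 := by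
    linear_combination z ^ 2 * Complex.I_sq
  rw [h4, h5]
  push_cast
  field_simp

/-! ### Lower bound for `w` in the first quadrant. -/

/-- A Chebyshev-type argument: `2 / √π - 2 t` has integral zero against `exp (-t²)` and changes sign
once, at `1 / √π`, so the decreasing weight `exp (-2 y t)` makes the integral nonnegative. -/
theorem halfGauss_lower {y : ℝ} (hy : 0 ≤ y) : √π ≤ 2 * (1 + √π * y) * halfGauss y := by
  have hp : 0 < √π := by positivity
  have h1 : 0 ≤ ∫ t in Ioi (0 : ℝ), (2 / √π * realKernel y t - 2 * t * realKernel y t) := by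
    have h2 : (∫ t in Ioi (0 : ℝ), exp (-2 * y * (1 / √π)) *
        (2 / √π * realKernel 0 t - 2 * t * realKernel 0 t)) = 0 := by
      rw [integral_const_mul, integral_sub ((integrable_realKernel 0).integrableOn.const_mul _)
        (integrable_mul_realKernel 0).integrableOn, integral_const_mul]
      have h3 := halfGauss_by_parts 0
      have h4 := halfGauss_zero
      unfold halfGauss at h3 h4
      rw [h4]
      have h5 : 2 / √π * (√π / 2) = 1 := by field_simp
      rw [h5]
      have : ∫ t in Ioi (0 : ℝ), 2 * t * realKernel 0 t = 1 := by linarith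
      rw [this]; simp
    refine h2.symm.trans_le (setIntegral_mono_on
      ((((integrable_realKernel 0).const_mul _).sub (integrable_mul_realKernel 0)).const_mul
        _).integrableOn
      (((integrable_realKernel y).const_mul _).sub (integrable_mul_realKernel y)).integrableOn
      measurableSet_Ioi fun t _ => ?_)
    have h5 : realKernel y t = exp (-2 * y * t) * realKernel 0 t := by
      rw [realKernel, realKernel, ← exp_add]; congr 1; ring
    rw [h5]
    have h6 : 0 ≤ (1 / √π - t) * (exp (-2 * y * t) - exp (-2 * y * (1 / √π))) := by
      rcases le_total t (1 / √π) with h | h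
      · refine mul_nonneg (by linarith) (sub_nonneg.2 (exp_le_exp.2 ?_))
        nlinarith [mul_le_mul_of_nonneg_left h hy]
      · refine mul_nonneg_of_nonpos_of_nonpos (by linarith) (sub_nonpos.2 (exp_le_exp.2 ?_))
        nlinarith [mul_le_mul_of_nonneg_left h hy]
    have h7 := mul_nonneg h6 (realKernel_pos 0 t).le
    have h8 : 2 / √π = 2 * (1 / √π) := by ring
    rw [h8]
    nlinarith
  rw [integral_sub ((integrable_realKernel y).integrableOn.const_mul _)
    (integrable_mul_realKernel y).integrableOn, integral_const_mul] at h1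
  have h9 := halfGauss_by_parts y
  have h10 : 2 / √π * halfGauss y = 2 / √π * ∫ t in Ioi (0 : ℝ), realKernel y t := rfl
  have h11 : 1 ≤ 2 / √π * halfGauss y + 2 * y * halfGauss y := by linarith
  have h12 := mul_le_mul_of_nonneg_left h11 hp.le
  have h13 : √π * (2 / √π * halfGauss y + 2 * y * halfGauss y)
      = 2 * (1 + √π * y) * halfGauss y := by field_simp
  linarith

theorem two_mul_mul_halfGauss_le_one {y : ℝ} : 2 * y * halfGauss y ≤ 1 := by
  rw [halfGauss_by_parts, sub_le_self_iff]
  exact setIntegral_nonneg measurableSet_Ioi fun t ht =>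
    mul_nonneg (by have : 0 < t := ht; positivity) (realKernel_pos y t).le

theorem w_ofReal_mul_I (y : ℝ) : w (y * Complex.I) = ((2 / √π * halfGauss y : ℝ) : ℂ) := by
  rw [w_eq_integral]
  simp only [kernel_ofReal_mul_I]
  rw [integral_complex_ofReal, halfGauss]
  push_cast
  rfl

theorem hasDerivAt_w_horizontal (y x : ℝ) :
    HasDerivAt (fun x : ℝ => w (x + y * Complex.I))
      (-2 * (x + y * Complex.I) * w (x + y * Complex.I) + 2 * Complex.I / ((√π : ℝ) : ℂ)) x := by
  have h1 : HasDerivAt (fun x : ℝ => (x : ℂ) + y * Complex.I) 1 x := by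
    simpa using ((hasDerivAt_id x).ofReal_comp).add_const (y * Complex.I)
  have h2 := (hasDerivAt_w (x + y * Complex.I)).comp x h1
  rw [mul_one] at h2
  exact h2

theorem hasDerivAt_w_re (y x : ℝ) :
    HasDerivAt (fun x : ℝ => (w (x + y * Complex.I)).re)
      (-2 * (x * (w (x + y * Complex.I)).re - y * (w (x + y * Complex.I)).im)) x := by
  have h := (hasDerivAt_w_horizontal y x)
  have h2 := Complex.reCLM.hasFDerivAt.comp_hasDerivAt x h
  refine h2.congr_deriv ?_
  have h3 : (2 * Complex.I / ((√π : ℝ) : ℂ)).re = 0 := by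
    rw [Complex.div_ofReal_re]; simp
  simp only [Complex.reCLM_apply, Complex.add_re, h3]
  simp
  ring

theorem hasDerivAt_w_im (y x : ℝ) :
    HasDerivAt (fun x : ℝ => (w (x + y * Complex.I)).im)
      (-2 * (x * (w (x + y * Complex.I)).im + y * (w (x + y * Complex.I)).re) + 2 / √π) x := by
  have h := (hasDerivAt_w_horizontal y x)
  have h2 := Complex.imCLM.hasFDerivAt.comp_hasDerivAt x h
  refine h2.congr_deriv ?_
  have h3 : (2 * Complex.I / ((√π : ℝ) : ℂ)).im = 2 / √π := by
    rw [Complex.div_ofReal_im]; simp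
  simp only [Complex.imCLM_apply, Complex.add_im, h3]
  simp
  ring

/-- In `x`, `v = Im w` satisfies `v' + 2 x v = 2 / √π - 2 y Re w ≥ k`, while `g = k x / (1 + 2 x²)`
satisfies `g' + 2 x g ≤ k`. Both vanish at 0, so multiplying by the integrating factor `exp (x²)`
gives `g ≤ v`. -/
theorem w_im_lower {x y : ℝ} (hx : 0 ≤ x) (hy : 0 ≤ y) :
    2 * (1 - 2 * y * halfGauss y) * x ≤ √π * (1 + 2 * x ^ 2) * (w (x + y * Complex.I)).im := by
  have hp : 0 < √π := by positivity
  set k := 2 / √π * (1 - 2 * y * halfGauss y) with hk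
  have hmono : MonotoneOn (fun x : ℝ => exp (x ^ 2) * ((w (x + y * Complex.I)).im
      - k * (x / (1 + 2 * x ^ 2)))) (Ici 0) := by
    have hd : ∀ x : ℝ, HasDerivAt (fun x : ℝ => exp (x ^ 2) * ((w (x + y * Complex.I)).im
      - k * (x / (1 + 2 * x ^ 2)))) (exp (x ^ 2) * (2 / √π - 2 * y * (w (x + y * Complex.I)).re
        - k * ((1 + 4 * x ^ 4) / (1 + 2 * x ^ 2) ^ 2))) x := by
      intro x
      have hne : 1 + 2 * x ^ 2 ≠ 0 := by positivity
      have h1 : HasDerivAt (fun x : ℝ => exp (x ^ 2)) (exp (x ^ 2) * (2 * x)) x := by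
        simpa using ((hasDerivAt_id x).pow 2).exp
      have h2 : HasDerivAt (fun x : ℝ => 1 + 2 * x ^ 2) (4 * x) x := by
        have := (((hasDerivAt_id x).pow 2).const_mul 2).const_add 1
        refine this.congr_deriv ?_
        simp; ring
      have h3 := ((hasDerivAt_id x).div h2 hne).const_mul k
      have := h1.mul ((hasDerivAt_w_im y x).sub h3)
      refine this.congr_deriv ?_
      simp
      field_simp
      ring
    refine monotoneOn_of_deriv_nonneg (convex_Ici 0)
      (fun x _ => (hd x).continuousAt.continuousWithinAt)
      (fun x _ => (hd x).differentiableAt.differentiableWithinAt) fun x _ => ?_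
    rw [(hd x).deriv]
    refine mul_nonneg (exp_pos _).le ?_
    have h1 : (w (x + y * Complex.I)).re ≤ 2 / √π * halfGauss y :=
      (Complex.re_le_norm _).trans (by simpa using norm_w_le_halfGauss (x + y * Complex.I))
    have h2 : (1 + 4 * x ^ 4) / (1 + 2 * x ^ 2) ^ 2 ≤ 1 := by
      rw [div_le_one (by positivity)]; nlinarith [sq_nonneg (x ^ 2)]
    have h3 : 0 ≤ k := mul_nonneg (by positivity) (by
      have := two_mul_mul_halfGauss_le_one (y := y); linarith)
    have h4 : k = 2 / √π - 2 * y * (2 / √π * halfGauss y) := by rw [hk]; ring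
    nlinarith [mul_le_mul_of_nonneg_left h1 hy, mul_le_mul_of_nonneg_left h2 h3]
  have h := hmono (by simp : (0 : ℝ) ∈ Ici 0) hx hx
  have h0 : (w (((0 : ℝ) : ℂ) + y * Complex.I)).im = 0 := by
    rw [Complex.ofReal_zero, zero_add, w_ofReal_mul_I, Complex.ofReal_im]
  simp only [h0] at h
  simp only [zero_div, mul_zero, sub_zero] at h
  have h1 := nonneg_of_mul_nonneg_right h (exp_pos _)
  have hne : 0 < 1 + 2 * x ^ 2 := by positivity
  have h2 : k * (x / (1 + 2 * x ^ 2)) * (√π * (1 + 2 * x ^ 2))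
      = 2 * (1 - 2 * y * halfGauss y) * x := by
    rw [hk]; field_simp
  rw [← h2]
  nlinarith [mul_nonneg h1 (mul_pos hp hne).le]

theorem w_im_nonneg {x y : ℝ} (hx : 0 ≤ x) (hy : 0 ≤ y) : 0 ≤ (w (x + y * Complex.I)).im := by
  have h := w_im_lower hx hy
  have h2 := two_mul_mul_halfGauss_le_one (y := y)
  have h3 : 0 ≤ 2 * (1 - 2 * y * halfGauss y) * x := by
    have : 0 ≤ 1 - 2 * y * halfGauss y := by linarith
    positivity
  exact nonneg_of_mul_nonneg_right (h3.trans h) (by positivity)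

/-- The derivative of `exp (x²) Re w` in `x` is `2 y exp (x²) Im w ≥ 0`; the left side is the value
at `x = 0`. -/
theorem w_re_lower {x y : ℝ} (hx : 0 ≤ x) (hy : 0 ≤ y) :
    2 / √π * halfGauss y ≤ exp (x ^ 2) * (w (x + y * Complex.I)).re := by
  have hd : ∀ x : ℝ, HasDerivAt (fun x : ℝ => exp (x ^ 2) * (w (x + y * Complex.I)).re)
      (exp (x ^ 2) * (2 * y * (w (x + y * Complex.I)).im)) x := by
    intro x
    have h1 : HasDerivAt (fun x : ℝ => exp (x ^ 2)) (exp (x ^ 2) * (2 * x)) x := by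
      simpa using ((hasDerivAt_id x).pow 2).exp
    refine (h1.mul (hasDerivAt_w_re y x)).congr_deriv ?_
    ring
  have hmono : MonotoneOn (fun x : ℝ => exp (x ^ 2) * (w (x + y * Complex.I)).re) (Ici 0) := by
    refine monotoneOn_of_deriv_nonneg (convex_Ici 0)
      (fun x _ => (hd x).continuousAt.continuousWithinAt)
      (fun x _ => (hd x).differentiableAt.differentiableWithinAt) fun x hx => ?_
    rw [(hd x).deriv]
    rw [interior_Ici] at hx
    have := w_im_nonneg (le_of_lt hx) hy
    positivity
  have h := hmono (by simp : (0 : ℝ) ∈ Ici 0) hx hx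
  have h0 : (w (((0 : ℝ) : ℂ) + y * Complex.I)).re = 2 / √π * halfGauss y := by
    rw [Complex.ofReal_zero, zero_add, w_ofReal_mul_I, Complex.ofReal_re]
  simp only [h0] at h
  simpa using h

/-- A lower bound for the Faddeeva function in the first quadrant. -/
theorem one_le_mul_norm_w {z : ℂ} (hx : 0 ≤ z.re) (hy : 0 ≤ z.im) :
    1 ≤ 2 * (1 + √π * ‖z‖) * ‖w z‖ := by
  obtain ⟨x, y⟩ := z
  simp only at hx hy
  have hz : (⟨x, y⟩ : ℂ) = x + y * Complex.I := Complex.mk_eq_add_mul_I x y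
  have hp : 0 < √π := by positivity
  have hyz : y ≤ ‖(⟨x, y⟩ : ℂ)‖ := (le_abs_self y).trans (Complex.abs_im_le_norm ⟨x, y⟩)
  have hre := w_re_lower hx hy
  have him := w_im_lower hx hy
  have hmod := mul_halfGauss_le_norm_w (⟨x, y⟩ : ℂ)
  have hren := Complex.re_le_norm (w (⟨x, y⟩ : ℂ))
  have himn := (le_abs_self _).trans (Complex.abs_im_le_norm (w (⟨x, y⟩ : ℂ)))
  rw [← hz] at hre him
  set W := ‖w (⟨x, y⟩ : ℂ)‖
  set Z := ‖(⟨x, y⟩ : ℂ)‖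
  have hW : 0 ≤ W := norm_nonneg _
  have hm := halfGauss_lower hy
  have hm0 := halfGauss_nonneg y
  -- For small `x` the real part suffices, since `exp (x²) ≤ 2` up to `x = 4/5`. For larger `x` the
  -- bound on the imaginary part is combined with the one on `2 y halfGauss y`.
  rcases le_total x (4 / 5) with hx1 | hx1
  · have he : exp (x ^ 2) ≤ 2 := by
      -- The bound `exp (16/25) ≤ 2` is checked on 25th powers, as `e^16 ≤ 2^25`.
      refine (exp_le_exp.2 (by nlinarith : x ^ 2 ≤ 16 / 25)).trans ?_
      have h1 : exp (16 / 25) ^ 25 = exp 1 ^ 16 := by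
        rw [← exp_nat_mul, ← exp_nat_mul]; norm_num
      have h2 : exp 1 ^ 16 ≤ (2.7182818286 : ℝ) ^ 16 := by
        gcongr; exact exp_one_lt_d9.le
      refine le_of_pow_le_pow_left₀ (n := 25) (by norm_num) (by norm_num) ?_
      rw [h1]; refine h2.trans ?_; norm_num
    have h1 : 2 / √π * halfGauss y ≤ 2 * W :=
      hre.trans ((mul_le_mul_of_nonneg_left hren (exp_pos _).le).trans (by gcongr))
    have h2 : 2 * halfGauss y ≤ 2 * W * √π := by
      rw [div_mul_eq_mul_div, div_le_iff₀ hp] at h1; exact h1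
    have h3 : √π ≤ (1 + √π * y) * (2 * W * √π) :=
      hm.trans (by nlinarith [mul_le_mul_of_nonneg_left h2 (by positivity : 0 ≤ 1 + √π * y)])
    have h4 : 1 ≤ (1 + √π * y) * (2 * W) := by
      by_contra hcon
      push Not at hcon
      nlinarith [mul_lt_mul_of_pos_right hcon hp]
    have h5 : √π * y ≤ √π * Z := by gcongr
    nlinarith [mul_le_mul_of_nonneg_right h5 hW]
  · set t := 2 * y * halfGauss y
    have h1 : 2 * (1 - t) * x ≤ √π * (1 + 2 * x ^ 2) * W :=
      him.trans (mul_le_mul_of_nonneg_left himn (by positivity))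
    -- Adding `2 x t ≤ 2 x √π Z W` to `h1` eliminates `t`.
    have h2 : 2 * x ≤ √π * W * (1 + 2 * x ^ 2 + 2 * x * Z) := by
      change t ≤ √π * Z * W at hmod
      nlinarith [mul_le_mul_of_nonneg_left hmod (by linarith : 0 ≤ 2 * x)]
    have hxz : x ≤ Z := (le_abs_self x).trans (Complex.abs_re_le_norm ⟨x, y⟩)
    have hs : √π ≤ 1.8 := by
      rw [sqrt_le_iff]; constructor <;> norm_num; linarith [pi_lt_d2]
    have h3 : √π * (1 + 2 * x ^ 2 + 2 * x * Z) ≤ 4 * x * (1 + √π * Z) := by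
      nlinarith [mul_nonneg (mul_nonneg hp.le (by linarith : 0 ≤ x)) (sub_nonneg.2 hxz)]
    have h4 : 2 * x ≤ 2 * x * (2 * (1 + √π * Z) * W) := by
      nlinarith [mul_le_mul_of_nonneg_right h3 hW]
    exact le_of_mul_le_mul_left (by linarith) (by linarith : 0 < 2 * x)

/-! ### Poisson summation and the dual series. -/

/-- The phase of the `n`-th dual term in Poisson summation over a grid shifted by `α`. -/
def phase (α : ℝ) (n : ℤ) : ℂ := Complex.exp (2 * π * Complex.I * α * n)

theorem norm_phase (α : ℝ) (n : ℤ) : ‖phase α n‖ = 1 := by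
  rw [phase, Complex.norm_exp]
  simp

theorem poisson_shifted_gaussian {h : ℝ} (hh : 0 < h) (α t : ℝ) :
    (h : ℂ) * ∑' k : ℤ, Complex.exp (-(((k + α) * h : ℝ) : ℂ) ^ 2
        - 2 * Complex.I * ((k + α) * h : ℝ) * t)
      = ((√π : ℝ) : ℂ) * ∑' n : ℤ, phase α n * Complex.exp (-((t + n * (π / h) : ℝ) : ℂ) ^ 2) := by
  have hc : (h : ℂ) ≠ 0 := by exact_mod_cast hh.ne'
  have hpc : (π : ℂ) ≠ 0 := by exact_mod_cast pi_pos.ne'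
  have hs : ((√π : ℝ) : ℂ) ≠ 0 := by exact_mod_cast (by positivity : √π ≠ 0)
  -- The parameters come from expanding the exponent in powers of `k`; the part free of `k` is the
  -- factor `A` below.
  have key := Complex.tsum_exp_neg_quadratic (a := ((h ^ 2 / π : ℝ) : ℂ))
    (by rw [Complex.ofReal_re]; positivity) (-(α * h ^ 2 + Complex.I * t * h) / π)
  have h1 : ((h ^ 2 / π : ℝ) : ℂ) ^ (1 / 2 : ℂ) = ((h / √π : ℝ) : ℂ) := by
    have : h / √π = (h ^ 2 / π) ^ (1 / 2 : ℝ) := by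
      rw [← Real.sqrt_eq_rpow, Real.sqrt_div (by positivity), Real.sqrt_sq hh.le]
    rw [this, Complex.ofReal_cpow (by positivity)]
    norm_num
  rw [h1] at key
  set A : ℂ := Complex.exp (-(α * h) ^ 2 - 2 * Complex.I * t * (α * h)) with hA
  have h2 : ∀ k : ℤ, Complex.exp (-(((k + α) * h : ℝ) : ℂ) ^ 2
      - 2 * Complex.I * ((k + α) * h : ℝ) * t)
      = A * Complex.exp (-π * ((h ^ 2 / π : ℝ) : ℂ) * k ^ 2
        + 2 * π * (-(α * h ^ 2 + Complex.I * t * h) / π) * k) := by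
    intro k
    rw [hA, ← Complex.exp_add]
    congr 1
    push_cast
    field_simp
    ring
  have h3 : ∀ n : ℤ, phase α n * Complex.exp (-((t + n * (π / h) : ℝ) : ℂ) ^ 2)
      = A * Complex.exp (-π / ((h ^ 2 / π : ℝ) : ℂ) *
        (n + Complex.I * (-(α * h ^ 2 + Complex.I * t * h) / π)) ^ 2) := by
    intro n
    rw [hA, phase, ← Complex.exp_add, ← Complex.exp_add]
    congr 1
    push_cast
    field_simp
    ring_nf
    simp only [Complex.I_sq, Complex.I_pow_three, Complex.I_pow_four]
    ring
  simp only [h2, h3, tsum_mul_left, key]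
  push_cast
  field_simp

theorem summable_exp_neg_int {f : ℤ → ℝ} {c d : ℝ} (hc : 0 < c) (hf : ∀ n, 0 ≤ f n)
    (h1 : ∀ n : ℕ, f n ≤ exp (d - n * c)) (h2 : ∀ n : ℕ, f (-n) ≤ exp (d - n * c)) :
    Summable f := by
  have hs : Summable fun n : ℕ => exp (d - n * c) := by
    have := (Real.summable_exp_nat_mul_iff.2 (neg_lt_zero.2 hc)).mul_left (exp d)
    refine this.congr fun n => ?_
    rw [← exp_add]; congr 1; ring
  exact Summable.of_nat_of_neg (hs.of_nonneg_of_le (fun _ => hf _) h1)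
    (hs.of_nonneg_of_le (fun _ => hf _) h2)

theorem summable_gaussian_grid {h : ℝ} (hh : 0 < h) (α : ℝ) :
    Summable fun k : ℤ => exp (-((k + α) * h) ^ 2) := by
  refine summable_exp_neg_int (c := 2 * h ^ 2) (d := (1 + 2 * |α|) * h ^ 2) (by positivity)
    (fun _ => (exp_pos _).le) (fun n => exp_le_exp.2 ?_) (fun n => exp_le_exp.2 ?_)
  · push_cast
    nlinarith [mul_nonneg (sq_nonneg ((n : ℝ) + α - 1)) (sq_nonneg h),
      mul_nonneg (neg_le_iff_add_nonneg.1 (neg_abs_le α)) (sq_nonneg h)]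
  · push_cast
    nlinarith [mul_nonneg (sq_nonneg ((n : ℝ) - α - 1)) (sq_nonneg h),
      mul_nonneg (sub_nonneg.2 (le_abs_self α)) (sq_nonneg h)]

/-- The `n`-th term of the dual (Poisson) series of the trapezoidal sum. -/
def dualTerm (b α : ℝ) (z : ℂ) (n : ℤ) : ℂ :=
  phase α n * (exp (-(n * b) ^ 2) : ℂ) * w (z + (n * b : ℝ) * Complex.I)

/-- The Cauchy-type term `exp (-s²) / (z - s)` at the `k`-th node of the bi-infinite grid. -/
def cauchyTerm (h α : ℝ) (z : ℂ) (k : ℤ) : ℂ :=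
  (exp (-((k + α) * h) ^ 2) : ℂ) / (z - ((k + α) * h : ℝ))

theorem exp_mul_halfGauss_le_nat (b : ℝ) {y : ℝ} (hb : 0 < b) (hy : 0 < y) (n : ℕ) :
    exp (-(n * b) ^ 2) * halfGauss (y + n * b) ≤ √π * exp (-(n * b) ^ 2) := by
  rw [mul_comm]
  gcongr
  refine (halfGauss_anti (by positivity : 0 ≤ y + n * b)).trans ?_
  rw [halfGauss_zero]
  linarith [sqrt_nonneg π]

theorem exp_mul_halfGauss_le (b y : ℝ) (n : ℝ) :
    exp (-(n * b) ^ 2) * halfGauss (y + n * b) ≤ √π * exp (y ^ 2 + 2 * y * n * b) := by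
  calc _ ≤ exp (-(n * b) ^ 2) * (√π * exp ((y + n * b) ^ 2)) := by
        gcongr; exact halfGauss_le _
    _ = √π * (exp (-(n * b) ^ 2) * exp ((y + n * b) ^ 2)) := by ring
    _ = _ := by rw [← exp_add]; ring_nf

/-- The two ends differ: Gaussian decay as `n → +∞`, but as `n → -∞` the growth of `halfGauss`
cancels the Gaussian and leaves `exp (y² + 2 y n b)`, which decays because `y > 0`. -/
theorem summable_exp_mul_halfGauss {b y : ℝ} (hb : 0 < b) (hy : 0 < y) :
    Summable fun n : ℤ => exp (-(n * b) ^ 2) * halfGauss (y + n * b) := by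
  have hp : √π ≤ exp (log √π) := (exp_log (by positivity)).ge
  have hp' : 0 < √π := by positivity
  refine summable_exp_neg_int (c := min (b ^ 2) (2 * y * b)) (d := y ^ 2 + log √π)
    (lt_min (by positivity) (by positivity))
    (fun _ => mul_nonneg (exp_pos _).le (halfGauss_nonneg _)) (fun n => ?_) (fun n => ?_)
  · refine (exp_mul_halfGauss_le_nat b hb hy n).trans ?_
    calc √π * exp (-(n * b) ^ 2) ≤ exp (log √π) * exp (-(n * b) ^ 2) := by gcongr
      _ ≤ _ := by
        rw [← exp_add]
        refine exp_le_exp.2 ?_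
        have h1 : (n : ℝ) * min (b ^ 2) (2 * y * b) ≤ n * b ^ 2 := by
          gcongr; exact min_le_left _ _
        have h2 : (n : ℝ) * b ^ 2 ≤ (n * b) ^ 2 := by
          rw [mul_pow]
          gcongr
          exact_mod_cast Nat.le_self_pow two_ne_zero n
        nlinarith [sq_nonneg y]
  · have h0 := exp_mul_halfGauss_le b y (-n)
    push_cast
    refine h0.trans ?_
    calc √π * exp (y ^ 2 + 2 * y * -n * b) ≤ exp (log √π) * exp (y ^ 2 + 2 * y * -n * b) := by
          gcongr
      _ ≤ _ := by
        rw [← exp_add]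
        refine exp_le_exp.2 ?_
        have h1 : (n : ℝ) * min (b ^ 2) (2 * y * b) ≤ n * (2 * y * b) := by
          gcongr; exact min_le_right _ _
        linarith

/-- Termwise integration of the Laplace formula `∫ exp (2 i (z - s) t) dt = i / (2 (z - s))`, where
`Im z > 0` gives convergence. -/
theorem hasSum_cauchyTerm {h : ℝ} (hh : 0 < h) (α : ℝ) {z : ℂ} (hz : 0 < z.im) :
    HasSum (fun k : ℤ => Complex.I / 2 * cauchyTerm h α z k)
      (∫ t in Ioi (0 : ℝ), ∑' k : ℤ, Complex.exp (2 * Complex.I * z * t) *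
        Complex.exp (-(((k + α) * h : ℝ) : ℂ) ^ 2 - 2 * Complex.I * ((k + α) * h : ℝ) * t)) := by
  have hF : ∀ (k : ℤ) (t : ℝ), Complex.exp (2 * Complex.I * z * t) *
      Complex.exp (-(((k + α) * h : ℝ) : ℂ) ^ 2 - 2 * Complex.I * ((k + α) * h : ℝ) * t)
      = (exp (-((k + α) * h) ^ 2) : ℂ) *
        Complex.exp (2 * Complex.I * (z - ((k + α) * h : ℝ)) * t) := by
    intro k t
    rw [Complex.ofReal_exp, ← Complex.exp_add, ← Complex.exp_add]
    congr 1
    push_cast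
    ring
  simp only [hF]
  have hre : ∀ s : ℝ, (2 * Complex.I * (z - s)).re = -2 * z.im := by intro s; simp
  have hneg : ∀ s : ℝ, (2 * Complex.I * (z - s)).re < 0 := by intro s; rw [hre]; linarith
  have hint : ∀ k : ℤ, ∫ t in Ioi (0 : ℝ), (exp (-((k + α) * h) ^ 2) : ℂ) *
        Complex.exp (2 * Complex.I * (z - ((k + α) * h : ℝ)) * t)
      = Complex.I / 2 * cauchyTerm h α z k := by
    intro k
    rw [integral_const_mul, integral_exp_mul_complex_Ioi (hneg _), cauchyTerm]
    have hne : z - ((k + α) * h : ℝ) ≠ 0 := by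
      intro h0
      have := congrArg Complex.im h0
      simp only [Complex.sub_im, Complex.ofReal_im, Complex.zero_im] at this
      linarith
    simp only [Complex.ofReal_zero, mul_zero, Complex.exp_zero]
    have hI := Complex.I_ne_zero
    field_simp
    rw [Complex.I_sq]
  simp only [← hint]
  refine hasSum_integral_of_summable_integral_norm
    (fun k => (integrableOn_exp_mul_complex_Ioi (hneg _) 0).const_mul _) ?_
  refine ((summable_gaussian_grid hh α).mul_right
    (∫ t in Ioi (0 : ℝ), exp (-2 * z.im * t))).congr fun k => ?_
  rw [← integral_const_mul]
  congr 1
  ext t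
  rw [norm_mul, Complex.norm_exp, ← hre ((k + α) * h), Complex.norm_real,
    norm_of_nonneg (exp_pos _).le, Complex.re_mul_ofReal]

/-- Expanding `(t + n b)²` turns `exp (2 i z t)` times the shifted Gaussian into `exp (-(n b)²)`
times the kernel at `z + i n b`. -/
theorem hasSum_dualTerm {b : ℝ} (hb : 0 < b) (α : ℝ) {z : ℂ} (hz : 0 < z.im) :
    HasSum (fun n : ℤ => ((√π / 2 : ℝ) : ℂ) * dualTerm b α z n)
      (∫ t in Ioi (0 : ℝ), ∑' n : ℤ, Complex.exp (2 * Complex.I * z * t) *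
        (phase α n * Complex.exp (-((t + n * b : ℝ) : ℂ) ^ 2))) := by
  have hp : ((√π : ℝ) : ℂ) ≠ 0 := by exact_mod_cast (by positivity : √π ≠ 0)
  have hG : ∀ (n : ℤ) (t : ℝ), Complex.exp (2 * Complex.I * z * t) *
        (phase α n * Complex.exp (-((t + n * b : ℝ) : ℂ) ^ 2))
      = phase α n * (exp (-(n * b) ^ 2) : ℂ) * kernel (z + (n * b : ℝ) * Complex.I) t := by
    intro n t
    rw [mul_left_comm, mul_assoc (phase α n), kernel, Complex.ofReal_exp, ← Complex.exp_add,
      ← Complex.exp_add]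
    congr 2
    push_cast
    linear_combination (-2 * (n : ℂ) * b * t) * Complex.I_sq
  simp only [hG]
  have hint : ∀ n : ℤ, ((√π / 2 : ℝ) : ℂ) * dualTerm b α z n = ∫ t in Ioi (0 : ℝ),
      phase α n * (exp (-(n * b) ^ 2) : ℂ) * kernel (z + (n * b : ℝ) * Complex.I) t := by
    intro n
    rw [integral_const_mul, dualTerm, w_eq_integral]
    push_cast
    field_simp
  simp only [hint]
  refine hasSum_integral_of_summable_integral_norm
    (fun n => ((integrable_kernel _).integrableOn).const_mul _) ?_
  refine (summable_exp_mul_halfGauss hb hz).congr fun n => ?_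
  rw [halfGauss, ← integral_const_mul]
  congr 1
  ext t
  rw [norm_mul, norm_mul, norm_phase, one_mul, norm_kernel, Complex.norm_real, norm_of_nonneg (exp_pos _).le]
  simp

theorem summable_cauchyTerm {h : ℝ} (hh : 0 < h) (α : ℝ) {z : ℂ} (hz : 0 < z.im) :
    Summable (cauchyTerm h α z) := by
  have := (hasSum_cauchyTerm hh α hz).summable
  exact (summable_mul_left_iff (by simp [Complex.I_ne_zero])).1 this

theorem summable_dualTerm {b : ℝ} (hb : 0 < b) (α : ℝ) {z : ℂ} (hz : 0 < z.im) :
    Summable (dualTerm b α z) := by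
  have := (hasSum_dualTerm hb α hz).summable
  refine (summable_mul_left_iff ?_).1 this
  exact_mod_cast (by positivity : √π / 2 ≠ 0)

theorem tsum_cauchyTerm {h : ℝ} (hh : 0 < h) (α : ℝ) {z : ℂ} (hz : 0 < z.im) :
    Complex.I * h / π * ∑' k : ℤ, cauchyTerm h α z k = ∑' n : ℤ, dualTerm (π / h) α z n := by
  have h1 := (hasSum_cauchyTerm hh α hz).tsum_eq
  have h2 := (hasSum_dualTerm (div_pos pi_pos hh) α hz).tsum_eq
  rw [tsum_mul_left] at h1 h2
  have h3 : (h : ℂ) * (Complex.I / 2 * ∑' k : ℤ, cauchyTerm h α z k)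
      = ((√π : ℝ) : ℂ) * (((√π / 2 : ℝ) : ℂ) * ∑' n : ℤ, dualTerm (π / h) α z n) := by
    rw [h1, h2, ← integral_const_mul, ← integral_const_mul]
    congr 1
    ext t
    rw [tsum_mul_left, tsum_mul_left, mul_left_comm, poisson_shifted_gaussian hh α t,
      mul_left_comm]
  have hpc : (π : ℂ) ≠ 0 := by exact_mod_cast pi_pos.ne'
  have hs : ((√π : ℝ) : ℂ) * ((√π / 2 : ℝ) : ℂ) = π / 2 := by
    rw [← Complex.ofReal_mul, mul_div_assoc', mul_self_sqrt pi_pos.le]; push_cast; ring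
  rw [← mul_assoc, ← mul_assoc, hs] at h3
  field_simp
  linear_combination 2 * h3

/-- The part of the infinite quadrature sum that is dropped by `truncApprox`. -/
def tail (h α : ℝ) (N : ℕ) (z : ℂ) : ℂ :=
  2 * (h : ℂ) * ∑' j : ℕ, integrand z (node h α (j + (N + 1)))

theorem ne_ofReal_of_im_pos {z : ℂ} (hz : 0 < z.im) (s : ℝ) : z ≠ s := by
  rintro rfl
  simp at hz

theorem two_mul_integrand {z : ℂ} {s : ℝ} (h1 : z ≠ s) (h2 : z ≠ -s) :
    2 * integrand z s = Complex.I / π * (Complex.exp (-(s : ℂ) ^ 2) / (z - s)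
      + Complex.exp (-(s : ℂ) ^ 2) / (z + s)) := by
  have hpc : (π : ℂ) ≠ 0 := by exact_mod_cast pi_pos.ne'
  have h3 : z - s ≠ 0 := sub_ne_zero.2 h1
  have h4 : z + s ≠ 0 := by rwa [← sub_neg_eq_add, sub_ne_zero]
  have h5 : z ^ 2 - (s : ℂ) ^ 2 = (z - s) * (z + s) := by ring
  rw [integrand, h5]
  field_simp
  ring

/-- Partial fractions pair the nodes `s` and `-s`. For `α = 1/2` the indices `k` and `-(k + 1)` are
mirror images; for `α = 0` node 0 is its own mirror and has weight `h` instead of `2 h`. -/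
theorem truncApprox_add_tail {h α : ℝ} (hh : 0 < h) (hα : α = 0 ∨ α = 1 / 2) (N : ℕ) {z : ℂ}
    (hz : 0 < z.im) :
    truncApprox h α N z + tail h α N z = ∑' n : ℤ, dualTerm (π / h) α z n := by
  have hpc : (π : ℂ) ≠ 0 := by exact_mod_cast pi_pos.ne'
  have hsum := summable_cauchyTerm hh α hz
  have hm : ∀ s : ℝ, z ≠ -s := fun s => by simpa using ne_ofReal_of_im_pos hz (-s)
  rw [← tsum_cauchyTerm hh α hz, tail, truncApprox, truncRule]
  rcases hα with rfl | rfl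
  · have hpos : Summable fun k : ℕ => cauchyTerm h 0 z ((k : ℤ) + 1) :=
      hsum.comp_injective (i := fun k : ℕ => (k : ℤ) + 1) fun a b hab => by simpa using hab
    have hneg : Summable fun k : ℕ => cauchyTerm h 0 z (-((k : ℤ) + 1)) :=
      hsum.comp_injective (i := fun k : ℕ => -((k : ℤ) + 1)) fun a b hab => by simpa using hab
    have hpair : ∀ k : ℕ, Complex.I * h / π * (cauchyTerm h 0 z ((k : ℤ) + 1)
        + cauchyTerm h 0 z (-((k : ℤ) + 1))) = 2 * h * integrand z (node h 0 (k + 1)) := by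
      intro k
      have := two_mul_integrand (ne_ofReal_of_im_pos hz (node h 0 (k + 1))) (hm _)
      rw [mul_right_comm, this, cauchyTerm, cauchyTerm, node]
      push_cast
      ring_nf
    have hs : Summable fun k : ℕ => 2 * (h : ℂ) * integrand z (node h 0 (k + 1)) :=
      ((hpos.add hneg).mul_left (Complex.I * h / π)).congr hpair
    have hzero : Complex.I * h / π * cauchyTerm h 0 z 0 = h * integrand z 0 := by
      have hz0 : z ≠ 0 := by simpa using ne_ofReal_of_im_pos hz 0
      rw [cauchyTerm, integrand]
      simp
      field_simp
    have e1 : Complex.I * h / π * (∑' k : ℕ, (cauchyTerm h 0 z ((k : ℤ) + 1)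
        + cauchyTerm h 0 z (-((k : ℤ) + 1)))) = ∑' k : ℕ, 2 * h * integrand z (node h 0 (k + 1)) := by
      rw [← tsum_mul_left]
      exact tsum_congr hpair
    have e2 : ∑ k ∈ Finset.range N, integrand z (node h 0 (k + 1))
        = ∑ k ∈ Finset.Icc 1 N, integrand z (node h 0 k) := by
      rw [Finset.range_eq_Ico, Finset.sum_Ico_add' (fun k => integrand z (node h 0 k)) 0 N 1]
      rfl
    rw [hpos.tsum_add hneg, ← hs.sum_add_tsum_nat_add N, tsum_mul_left, ← Finset.mul_sum, e2] at e1
    simp only [add_assoc] at e1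
    rw [if_pos rfl, tsum_of_add_one_of_neg_add_one hpos hneg]
    linear_combination -e1 - hzero
  · have hpos : Summable fun k : ℕ => cauchyTerm h (1 / 2) z (k : ℤ) :=
      hsum.comp_injective (i := fun k : ℕ => (k : ℤ)) fun a b hab => by simpa using hab
    have hneg : Summable fun k : ℕ => cauchyTerm h (1 / 2) z (-((k : ℤ) + 1)) :=
      hsum.comp_injective (i := fun k : ℕ => -((k : ℤ) + 1)) fun a b hab => by simpa using hab
    have hpair : ∀ k : ℕ, Complex.I * h / π * (cauchyTerm h (1 / 2) z (k : ℤ)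
        + cauchyTerm h (1 / 2) z (-((k : ℤ) + 1))) = 2 * h * integrand z (node h (1 / 2) k) := by
      intro k
      have := two_mul_integrand (ne_ofReal_of_im_pos hz (node h (1 / 2) k)) (hm _)
      rw [mul_right_comm, this, cauchyTerm, cauchyTerm, node]
      push_cast
      ring_nf
    have hs : Summable fun k : ℕ => 2 * (h : ℂ) * integrand z (node h (1 / 2) k) :=
      ((hpos.add hneg).mul_left (Complex.I * h / π)).congr hpair
    have e1 : Complex.I * h / π * (∑' k : ℕ, (cauchyTerm h (1 / 2) z (k : ℤ)
        + cauchyTerm h (1 / 2) z (-((k : ℤ) + 1)))) = ∑' k : ℕ, 2 * h * integrand z (node h (1 / 2) k) := by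
      rw [← tsum_mul_left]
      exact tsum_congr hpair
    rw [hpos.tsum_add hneg, ← hs.sum_add_tsum_nat_add (N + 1), tsum_mul_left, ← Finset.mul_sum] at e1
    rw [if_neg (by norm_num), tsum_of_nat_of_neg_add_one hpos hneg]
    exact e1.symm

/-- The reflected dual terms, which remain after the correction term has been split off. -/
def reflectedTerm (b α : ℝ) (z : ℂ) (j : ℕ) : ℂ :=
  phase α (-((j : ℤ) + 1)) * (exp (-((j + 1) * b) ^ 2) : ℂ) *
    w (-z + ((j + 1) * b : ℝ) * Complex.I)

theorem tsum_dualTerm {b : ℝ} (hb : 0 < b) (α : ℝ) {z : ℂ} (hz : 0 < z.im) :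
    ∑' n : ℤ, dualTerm b α z n = w z + ∑' j : ℕ, dualTerm b α z ((j : ℤ) + 1)
      + ∑' j : ℕ, dualTerm b α z (-((j : ℤ) + 1)) := by
  have hsum := summable_dualTerm hb α hz
  have h0 : dualTerm b α z 0 = w z := by simp [dualTerm, phase]
  rw [tsum_of_add_one_of_neg_add_one
    (hsum.comp_injective (i := fun k : ℕ => (k : ℤ) + 1) fun a b hab => by simpa using hab)
    (hsum.comp_injective (i := fun k : ℕ => -((k : ℤ) + 1)) fun a b hab => by simpa using hab),
    h0, add_comm (w z)]

/-- By `w_add_w_neg`, each term is `2 exp (-z²) p^(j+1)` minus a reflected term, with `|p| < 1`. The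
geometric part sums to `2 exp (-z²) p / (1 - p) = -2 exp (-z²) / (1 - p⁻¹)`. -/
theorem tsum_dualTerm_neg {h α : ℝ} (hh : 0 < h) (hα : α = 0 ∨ α = 1 / 2) {z : ℂ}
    (hz : 0 < z.im) :
    ∑' j : ℕ, dualTerm (π / h) α z (-((j : ℤ) + 1))
      = -correction h α z - ∑' j : ℕ, reflectedTerm (π / h) α z j := by
  have hc : (h : ℂ) ≠ 0 := by exact_mod_cast hh.ne'
  set p : ℂ := Complex.exp (-2 * π * Complex.I * α + 2 * Complex.I * (π / h) * z) with hp
  have hp1 : ‖p‖ < 1 := by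
    rw [hp, Complex.norm_exp, exp_lt_one_iff]
    have : (-2 * π * Complex.I * α + 2 * Complex.I * (π / h) * z).re = -(2 * (π / h) * z.im) := by
      have h1 : ((π : ℂ) / h) = ((π / h : ℝ) : ℂ) := by push_cast; rfl
      rw [h1]
      simp
    rw [this, neg_lt_zero]
    positivity
  have hterm : ∀ j : ℕ, dualTerm (π / h) α z (-((j : ℤ) + 1))
      = 2 * Complex.exp (-z ^ 2) * p * p ^ j - reflectedTerm (π / h) α z j := by
    intro j
    have h1 := w_add_w_neg (z + ((-((j : ℝ) + 1)) * (π / h) : ℝ) * Complex.I)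
    have h2 : -(z + ((-((j : ℝ) + 1)) * (π / h) : ℝ) * Complex.I)
        = -z + (((j + 1) * (π / h) : ℝ)) * Complex.I := by push_cast; ring
    rw [h2] at h1
    have h3 : phase α (-((j : ℤ) + 1)) * (exp (-((j + 1) * (π / h)) ^ 2) : ℂ) *
        Complex.exp (-(z + ((-((j : ℝ) + 1)) * (π / h) : ℝ) * Complex.I) ^ 2)
        = Complex.exp (-z ^ 2) * p * p ^ j := by
      rw [mul_assoc (Complex.exp _) p, ← pow_succ', hp, ← Complex.exp_nat_mul, ← Complex.exp_add,
        phase, Complex.ofReal_exp, ← Complex.exp_add, ← Complex.exp_add]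
      congr 1
      push_cast
      linear_combination (-(((j : ℂ) + 1) * (π / h)) ^ 2) * Complex.I_sq
    rw [dualTerm, reflectedTerm]
    have h4 : (((-((j : ℤ) + 1) : ℤ) : ℝ)) = -((j : ℝ) + 1) := by push_cast; rfl
    have h5 : (-(-((j : ℝ) + 1) * (π / h)) ^ 2) = -((j + 1) * (π / h)) ^ 2 := by ring
    rw [h4, h5, eq_sub_of_add_eq h1]
    linear_combination 2 * h3
  have hgeo : Summable fun j : ℕ => 2 * Complex.exp (-z ^ 2) * p * p ^ j :=
    (summable_geometric_of_norm_lt_one hp1).mul_left _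
  have hdual : Summable fun j : ℕ => dualTerm (π / h) α z (-((j : ℤ) + 1)) :=
    (summable_dualTerm (div_pos pi_pos hh) α hz).comp_injective
      (i := fun k : ℕ => -((k : ℤ) + 1)) fun a b hab => by simpa using hab
  have href : Summable (reflectedTerm (π / h) α z) :=
    (hgeo.sub hdual).congr fun j => by rw [hterm]; ring
  rw [tsum_congr hterm, hgeo.tsum_sub href, tsum_mul_left, tsum_geometric_of_norm_lt_one hp1]
  congr 1
  have hpi : Complex.exp (-(2 * Complex.I * (π : ℂ) * ((α : ℂ) + z / (h : ℂ)))) = p⁻¹ := by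
    -- The phases in `p⁻¹` and in the correction have opposite signs of `α`; they agree because `2
    -- α` is an integer.
    have h4 : Complex.exp (4 * π * Complex.I * α) = 1 := by
      rcases hα with rfl | rfl
      · simp
      · rw [← Complex.exp_two_pi_mul_I]; congr 1; push_cast; ring
    rw [hp, ← Complex.exp_neg, ← mul_one (Complex.exp (-(2 * Complex.I * _ * _))), ← h4,
      ← Complex.exp_add]
    congr 1
    field_simp
    ring
  have hp0 : p ≠ 0 := Complex.exp_ne_zero _
  have hne : 1 - p ≠ 0 := by
    intro h0
    rw [← sub_eq_zero.1 h0] at hp1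
    simp at hp1
  have hne2 : 1 - p⁻¹ ≠ 0 := by
    intro h0
    apply hne
    have := sub_eq_zero.1 h0
    rw [← inv_inv p, ← this]; simp
  rw [correction, hpi]
  field_simp
  have hne3 : p - 1 ≠ 0 := by rwa [← neg_ne_zero, neg_sub]
  field_simp
  ring

theorem w_sub_truncApprox {h α : ℝ} (hh : 0 < h) (hα : α = 0 ∨ α = 1 / 2) (N : ℕ) {z : ℂ}
    (hz : 0 < z.im) :
    w z - truncApprox h α N z = tail h α N z - ∑' j : ℕ, dualTerm (π / h) α z ((j : ℤ) + 1)
      - ∑' j : ℕ, dualTerm (π / h) α z (-((j : ℤ) + 1)) := by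
  have h1 := truncApprox_add_tail hh hα N hz
  rw [tsum_dualTerm (div_pos pi_pos hh) α hz] at h1
  linear_combination -h1

theorem w_sub_rawModApprox {h α : ℝ} (hh : 0 < h) (hα : α = 0 ∨ α = 1 / 2) (N : ℕ) {z : ℂ}
    (hz : 0 < z.im) :
    w z - rawModApprox h α N z = tail h α N z - ∑' j : ℕ, dualTerm (π / h) α z ((j : ℤ) + 1)
      + ∑' j : ℕ, reflectedTerm (π / h) α z j := by
  have h1 := w_sub_truncApprox hh hα N hz
  rw [tsum_dualTerm_neg hh hα hz] at h1
  rw [rawModApprox]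
  linear_combination h1

/-! ### Geometric bounds for the dual terms. -/

/-- The factor `L` is 1 for absolute bounds and `1 + √π ‖z‖` for weighted ones. -/
theorem mul_norm_tsum_le {a : ℕ → ℂ} {L C q : ℝ} (hL : 0 < L) (hq0 : 0 ≤ q) (hq1 : q < 1)
    (ha : ∀ j, L * ‖a j‖ ≤ C * q ^ j) : L * ‖∑' j, a j‖ ≤ C * (1 - q)⁻¹ := by
  have h1 := tsum_of_norm_bounded ((hasSum_geometric_of_lt_one hq0 hq1).mul_left (C / L))
    (f := a) fun j => by rw [div_mul_eq_mul_div, le_div_iff₀ hL, mul_comm]; exact ha j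
  calc L * ‖∑' j, a j‖ ≤ L * (C / L * (1 - q)⁻¹) := by gcongr
    _ = C * (1 - q)⁻¹ := by field_simp

theorem exp_neg_pi_le : exp (-π) ≤ 1 / 20 := by
  have h1 : exp (-π) ≤ exp (-3) := exp_le_exp.2 (by linarith [pi_gt_three])
  have h2 : (20 : ℝ) ≤ exp 3 := by
    have h3 : exp 3 = exp 1 ^ 3 := by rw [← exp_nat_mul]; norm_num
    have h4 : (2.7182818283 : ℝ) ^ 3 ≤ exp 1 ^ 3 := by gcongr; exact exp_one_gt_d9.le
    rw [h3]; refine le_trans ?_ h4; norm_num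
  refine h1.trans ?_
  rw [exp_neg, one_div]
  exact inv_anti₀ (by norm_num) h2

theorem exp_neg_two_mul_le {B : ℝ} (hB : π ≤ B) (j : ℕ) :
    exp (-(2 * j * B)) ≤ (1 / 400) ^ j := by
  have h1 : exp (-(2 * j * B)) = (exp (-B) ^ 2) ^ j := by
    rw [← exp_nat_mul, ← exp_nat_mul]; congr 1; push_cast; ring
  have h2 : exp (-B) ≤ 1 / 20 := (exp_le_exp.2 (by linarith)).trans exp_neg_pi_le
  rw [h1]
  gcongr
  calc exp (-B) ^ 2 ≤ (1 / 20) ^ 2 := by gcongr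
    _ = 1 / 400 := by norm_num

theorem exp_neg_sq_le {b : ℝ} (hb : π ≤ b ^ 2) (j : ℕ) :
    exp (-((j + 1) * b) ^ 2) ≤ exp (-b ^ 2) * (1 / 400) ^ j := by
  refine le_trans ?_ (mul_le_mul_of_nonneg_left (exp_neg_two_mul_le hb j) (exp_pos _).le)
  rw [← exp_add]
  refine exp_le_exp.2 ?_
  nlinarith [mul_nonneg (sq_nonneg (j : ℝ)) (sq_nonneg b)]

theorem add_one_mul_pow_le (j : ℕ) : ((j : ℝ) + 1) * (1 / 400) ^ j ≤ (1 / 100) ^ j := by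
  have h1 : ((j : ℝ) + 1) ≤ 4 ^ j := by
    have := one_add_mul_le_pow (a := (3 : ℝ)) (by norm_num) j
    norm_num at this
    nlinarith [(Nat.cast_nonneg j : (0 : ℝ) ≤ j)]
  calc ((j : ℝ) + 1) * (1 / 400) ^ j ≤ 4 ^ j * (1 / 400) ^ j := by gcongr
    _ = (1 / 100) ^ j := by rw [← mul_pow]; norm_num

theorem two_mul_add_one_mul_pow_le (j : ℕ) :
    (2 * (j : ℝ) + 1) * (1 / 400) ^ j ≤ (1 / 100) ^ j := by
  have h1 : (2 * (j : ℝ) + 1) ≤ 4 ^ j := by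
    have := one_add_mul_le_pow (a := (3 : ℝ)) (by norm_num) j
    norm_num at this
    nlinarith [(Nat.cast_nonneg j : (0 : ℝ) ≤ j)]
  calc (2 * (j : ℝ) + 1) * (1 / 400) ^ j ≤ 4 ^ j * (1 / 400) ^ j := by gcongr
    _ = (1 / 100) ^ j := by rw [← mul_pow]; norm_num

theorem norm_dualTerm (b α : ℝ) (z : ℂ) (n : ℤ) :
    ‖dualTerm b α z n‖ = exp (-(n * b) ^ 2) * ‖w (z + (n * b : ℝ) * Complex.I)‖ := by
  rw [dualTerm, norm_mul, norm_mul, norm_phase, one_mul, Complex.norm_real,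
    norm_of_nonneg (exp_pos _).le]

theorem norm_reflectedTerm (b α : ℝ) (z : ℂ) (j : ℕ) :
    ‖reflectedTerm b α z j‖
      = exp (-((j + 1) * b) ^ 2) * ‖w (-z + ((j + 1) * b : ℝ) * Complex.I)‖ := by
  rw [reflectedTerm, norm_mul, norm_mul, norm_phase, one_mul, Complex.norm_real,
    norm_of_nonneg (exp_pos _).le]

theorem one_add_mul_norm_w_le {z : ℂ} (hz : 0 ≤ z.im) : (1 + √π * ‖z‖) * ‖w z‖ ≤ 3 := by
  have h1 := norm_w_le_one hz
  have h2 := sqrt_pi_mul_norm_w_le le_rfl (by simpa using hz)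
  simp only [mul_zero, zero_mul, add_zero] at h2
  linarith

theorem norm_le_norm_add_I {z : ℂ} {c : ℝ} (hz : 0 ≤ z.im) (hc : 0 ≤ c) :
    ‖z‖ ≤ ‖z + c * Complex.I‖ := by
  rw [← sq_le_sq₀ (norm_nonneg _) (norm_nonneg _), Complex.sq_norm, Complex.sq_norm,
    Complex.normSq_apply, Complex.normSq_apply]
  simp
  nlinarith [mul_nonneg hz hc]

/-- Moving up from the closed upper half-plane increases the modulus, so the weight at `z` is at
most the weight at the shifted point. The factor `100 / 99` sums the ratio `1 / 100`. -/
theorem norm_tsum_dualTerm_pos {b α : ℝ} (hb : 0 < b) (hb2 : π ≤ b ^ 2) {z : ℂ}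
    (hz : 0 ≤ z.im) :
    ‖∑' j : ℕ, dualTerm b α z ((j : ℤ) + 1)‖ ≤ exp (-b ^ 2) * (100 / 99) ∧
    (1 + √π * ‖z‖) * ‖∑' j : ℕ, dualTerm b α z ((j : ℤ) + 1)‖
      ≤ 3 * exp (-b ^ 2) * (100 / 99) := by
  have key : ∀ (j : ℕ) (L C : ℝ), 0 ≤ C →
      L * ‖w (z + ((j + 1) * b : ℝ) * Complex.I)‖ ≤ C →
      L * ‖dualTerm b α z ((j : ℤ) + 1)‖ ≤ C * exp (-b ^ 2) * (1 / 100) ^ j := by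
    intro j L C hC h
    rw [norm_dualTerm]
    push_cast at h ⊢
    calc L * (exp (-((j + 1) * b) ^ 2) * ‖w (z + (j + 1) * b * Complex.I)‖)
        = (L * ‖w (z + (j + 1) * b * Complex.I)‖) * exp (-((j + 1) * b) ^ 2) := by ring
      _ ≤ C * (exp (-b ^ 2) * (1 / 400) ^ j) := by
        gcongr; exact exp_neg_sq_le hb2 j
      _ ≤ C * (exp (-b ^ 2) * (1 / 100) ^ j) := by
        gcongr; norm_num
      _ = _ := by ring
  have him : ∀ j : ℕ, 0 ≤ (z + ((j + 1) * b : ℝ) * Complex.I).im := fun j => by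
    rw [Complex.add_im, Complex.im_ofReal_mul, Complex.I_im]; positivity
  constructor
  · have := mul_norm_tsum_le (L := 1) one_pos (by norm_num) (by norm_num) fun j =>
      key j 1 1 zero_le_one (by rw [one_mul]; exact norm_w_le_one (him j))
    norm_num at this ⊢
    exact this
  · have := mul_norm_tsum_le (L := 1 + √π * ‖z‖) (by positivity) (by norm_num) (by norm_num)
      fun j => key j (1 + √π * ‖z‖) 3 (by norm_num) (le_trans (by
        gcongr
        exact norm_le_norm_add_I hz (by positivity)) (one_add_mul_norm_w_le (him j)))
    norm_num at this ⊢
    exact this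

/-- The condition `Im z ≤ b` keeps every reflected argument in the closed upper half-plane. Passing
to the weight there costs `√π (j + 1) b`, which the decay in `j` absorbs. -/
theorem norm_tsum_reflectedTerm {b α : ℝ} (hb : 0 < b) (hb2 : π ≤ b ^ 2) {z : ℂ}
    (hz : z.im ≤ b) :
    ‖∑' j : ℕ, reflectedTerm b α z j‖ ≤ exp (-b ^ 2) * (100 / 99) ∧
    (1 + √π * ‖z‖) * ‖∑' j : ℕ, reflectedTerm b α z j‖
      ≤ (3 + √π * b) * exp (-b ^ 2) * (100 / 99) := by
  have key : ∀ (j : ℕ) (L C : ℝ), 0 ≤ C →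
      L * ‖w (-z + ((j + 1) * b : ℝ) * Complex.I)‖ ≤ C * (j + 1) →
      L * ‖reflectedTerm b α z j‖ ≤ C * exp (-b ^ 2) * (1 / 100) ^ j := by
    intro j L C hC h
    rw [norm_reflectedTerm]
    calc L * (exp (-((j + 1) * b) ^ 2) * ‖w (-z + ((j + 1) * b : ℝ) * Complex.I)‖)
        = (L * ‖w (-z + ((j + 1) * b : ℝ) * Complex.I)‖) * exp (-((j + 1) * b) ^ 2) := by ring
      _ ≤ (C * (j + 1)) * (exp (-b ^ 2) * (1 / 400) ^ j) := by
        gcongr; exact exp_neg_sq_le hb2 j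
      _ = C * (exp (-b ^ 2) * ((j + 1) * (1 / 400) ^ j)) := by ring
      _ ≤ C * (exp (-b ^ 2) * (1 / 100) ^ j) := by
        gcongr; exact add_one_mul_pow_le j
      _ = _ := by ring
  have him : ∀ j : ℕ, 0 ≤ (-z + ((j + 1) * b : ℝ) * Complex.I).im := fun j => by
    rw [Complex.add_im, Complex.im_ofReal_mul, Complex.I_im, Complex.neg_im]
    have : 0 ≤ j * b := by positivity
    linarith
  constructor
  · have := mul_norm_tsum_le (L := 1) one_pos (by norm_num) (by norm_num) fun j =>
      key j 1 1 zero_le_one (by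
        have := norm_w_le_one (him j)
        have hj : (0 : ℝ) ≤ j := by positivity
        linarith)
    norm_num at this ⊢
    exact this
  · have := mul_norm_tsum_le (L := 1 + √π * ‖z‖) (by positivity) (by norm_num) (by norm_num)
      fun j => key j (1 + √π * ‖z‖) (3 + √π * b) (by positivity) (by
        have h1 := one_add_mul_norm_w_le (him j)
        have h2 := norm_w_le_one (him j)
        have hj : (0 : ℝ) ≤ j := by positivity
        set ζ := -z + ((j + 1) * b : ℝ) * Complex.I with hζ
        have h3 : ‖z‖ ≤ ‖ζ‖ + (j + 1) * b := by
          have h4 := norm_sub_le (((j + 1) * b : ℝ) * Complex.I) ζ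
          have h5 : ((j + 1) * b : ℝ) * Complex.I - ζ = z := by rw [hζ]; ring
          rw [h5, norm_mul, Complex.norm_I, Complex.norm_real, norm_of_nonneg (by positivity)] at h4
          linarith
        calc (1 + √π * ‖z‖) * ‖w ζ‖ ≤ (1 + √π * (‖ζ‖ + (j + 1) * b)) * ‖w ζ‖ := by gcongr
          _ = (1 + √π * ‖ζ‖) * ‖w ζ‖ + √π * b * (j + 1) * ‖w ζ‖ := by ring
          _ ≤ 3 + √π * b * (j + 1) * 1 := by gcongr
          _ ≤ (3 + √π * b) * (j + 1) := by nlinarith)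
    norm_num at this ⊢
    exact this

/-- The arguments may sink to height `-j b`, where `w` can be as large as `2 exp ((j b)²)`; against
`exp (-((j + 1) b)²)` this still leaves `exp (-b²) exp (-2 j b²)`. -/
theorem norm_tsum_dualTerm_neg {b α : ℝ} (hb : 0 < b) (hb2 : π ≤ b ^ 2) {z : ℂ}
    (hz : b ≤ z.im) :
    ‖∑' j : ℕ, dualTerm b α z (-((j : ℤ) + 1))‖ ≤ 2 * exp (-b ^ 2) * (100 / 99) ∧
    (1 + √π * ‖z‖) * ‖∑' j : ℕ, dualTerm b α z (-((j : ℤ) + 1))‖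
      ≤ (4 + 2 * (√π * b)) * exp (-b ^ 2) * (100 / 99) := by
  have key : ∀ (j : ℕ) (L C : ℝ), 0 ≤ C →
      L * ‖w (z + (-((j + 1) * b) : ℝ) * Complex.I)‖ ≤ C * (2 * j + 1) * exp ((j * b) ^ 2) →
      L * ‖dualTerm b α z (-((j : ℤ) + 1))‖ ≤ C * exp (-b ^ 2) * (1 / 100) ^ j := by
    intro j L C hC h
    have h4 : (((-((j : ℤ) + 1) : ℤ) : ℝ)) * b = -(((j : ℝ) + 1) * b) := by push_cast; ring
    rw [norm_dualTerm, h4]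
    calc L * (exp (-(-((j + 1) * b)) ^ 2) * ‖w (z + (-((j + 1) * b) : ℝ) * Complex.I)‖)
        = (L * ‖w (z + (-((j + 1) * b) : ℝ) * Complex.I)‖) * exp (-(-((j + 1) * b)) ^ 2) := by ring
      _ ≤ (C * (2 * j + 1) * exp ((j * b) ^ 2)) * exp (-(-((j + 1) * b)) ^ 2) := by gcongr
      _ = C * (exp (-b ^ 2) * ((2 * j + 1) * exp (-(2 * j * b ^ 2)))) := by
        have : exp ((j * b) ^ 2) * exp (-(-((j + 1) * b)) ^ 2)
            = exp (-b ^ 2) * exp (-(2 * j * b ^ 2)) := by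
          rw [← exp_add, ← exp_add]; ring_nf
        linear_combination C * (2 * j + 1) * this
      _ ≤ C * (exp (-b ^ 2) * ((2 * j + 1) * (1 / 400) ^ j)) := by
        gcongr; exact exp_neg_two_mul_le hb2 j
      _ ≤ C * (exp (-b ^ 2) * (1 / 100) ^ j) := by
        gcongr; exact two_mul_add_one_mul_pow_le j
      _ = _ := by ring
  have him : ∀ j : ℕ, -(j * b) ≤ (z + (-((j + 1) * b) : ℝ) * Complex.I).im := fun j => by
    rw [Complex.add_im, Complex.im_ofReal_mul, Complex.I_im]
    linarith
  constructor
  · have := mul_norm_tsum_le (L := 1) one_pos (by norm_num) (by norm_num) fun j =>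
      key j 1 2 zero_le_two (by
        have := norm_w_le (him j)
        have hj : (0 : ℝ) ≤ j := by positivity
        nlinarith [exp_pos ((j * b) ^ 2)])
    norm_num at this ⊢
    exact this
  · have := mul_norm_tsum_le (L := 1 + √π * ‖z‖) (by positivity) (by norm_num) (by norm_num)
      fun j => key j (1 + √π * ‖z‖) (4 + 2 * (√π * b)) (by positivity) (by
        have hj : (0 : ℝ) ≤ j := by positivity
        have h1 := sqrt_pi_mul_norm_w_le (by positivity) (him j)
        have h2 := norm_w_le (him j)
        set ζ := z + (-((j + 1) * b) : ℝ) * Complex.I with hζ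
        have h3 : ‖z‖ ≤ ‖ζ‖ + (j + 1) * b := by
          have h4 := norm_sub_le ζ ((-((j + 1) * b) : ℝ) * Complex.I)
          have h5 : ζ - (-((j + 1) * b) : ℝ) * Complex.I = z := by rw [hζ]; ring
          rw [h5, norm_mul, Complex.norm_I, Complex.norm_real, norm_neg,
            norm_of_nonneg (by positivity)] at h4
          linarith
        have he : 1 ≤ exp ((j * b) ^ 2) := one_le_exp (by positivity)
        set e := exp ((j * b) ^ 2)
        calc (1 + √π * ‖z‖) * ‖w ζ‖ ≤ (1 + √π * (‖ζ‖ + (j + 1) * b)) * ‖w ζ‖ := by gcongr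
          _ = √π * ‖ζ‖ * ‖w ζ‖ + (1 + √π * b * (j + 1)) * ‖w ζ‖ := by ring
          _ ≤ (2 + 2 * (j * b) * √π * e) + (1 + √π * b * (j + 1)) * (2 * e) := by gcongr
          _ ≤ (4 + 2 * (√π * b)) * (2 * j + 1) * e := by
            nlinarith [mul_nonneg hj (by linarith : 0 ≤ e)])
    norm_num at this ⊢
    exact this

/-! ### The step size and the quadrature tail. -/

theorem step_pos (N : ℕ) : 0 < step N := by unfold step; positivity

theorem step_sq (N : ℕ) : step N ^ 2 * (N + 1) = π := by
  rw [step, sq_sqrt (by positivity)]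
  field_simp

theorem sqrt_pi_eq (N : ℕ) : √π = step N * √((N : ℝ) + 1) := by
  rw [step, sqrt_div pi_pos.le]
  field_simp

theorem pi_div_step (N : ℕ) : π / step N = (N + 1) * step N := by
  rw [div_eq_iff (step_pos N).ne']
  linarith [step_sq N]

theorem pi_div_step_sq (N : ℕ) : (π / step N) ^ 2 = π * (N + 1) := by
  rw [pi_div_step]
  linear_combination ((N : ℝ) + 1) * step_sq N

theorem pi_le_pi_div_step_sq (N : ℕ) : π ≤ (π / step N) ^ 2 := by
  rw [pi_div_step_sq]
  nlinarith [pi_pos, mul_nonneg pi_pos.le (Nat.cast_nonneg (α := ℝ) N)]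

theorem sqrt_pi_mul_pi_div_step (N : ℕ) : √π * (π / step N) = π * √((N : ℝ) + 1) := by
  rw [sqrt_pi_eq N]
  have := step_pos N
  field_simp

theorem one_le_sqrt_add_one (N : ℕ) : 1 ≤ √((N : ℝ) + 1) := by
  rw [one_le_sqrt]; linarith [Nat.cast_nonneg (α := ℝ) N]

theorem sqrt_pi_mul_step_le (N : ℕ) : √π * step N ≤ π := by
  have h1 : step N ≤ √π := by
    rw [sqrt_pi_eq N]
    nlinarith [step_pos N, one_le_sqrt_add_one N]
  calc √π * step N ≤ √π * √π := by gcongr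
    _ = π := mul_self_sqrt pi_pos.le

theorem one_le_pi_div_step (N : ℕ) : 1 ≤ π / step N := by
  have h1 := pi_le_pi_div_step_sq N
  have h2 : 0 < π / step N := div_pos pi_pos (step_pos N)
  nlinarith [pi_gt_three]

theorem exp_neg_pi_div_step_sq (N : ℕ) :
    exp (-(π / step N) ^ 2) = exp (-π) * exp (-π * N) := by
  rw [pi_div_step_sq, ← exp_add]; ring_nf

/-- The two bounds on `z / (z² - s²)` that hold when `z` keeps away from the node `s`. -/
def FarFromNode (h : ℝ) (z : ℂ) (s : ℝ) : Prop :=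
  ‖z‖ ≤ 4 / h * ‖z ^ 2 - (s : ℂ) ^ 2‖ ∧ ‖z‖ ^ 2 ≤ (1 + 4 / h * s) * ‖z ^ 2 - (s : ℂ) ^ 2‖

/-- In this sector `|z² - s²|² ≥ |z|⁴ + s⁴`, so `|z² - s²|` dominates both `|z|²` and `s |z|`. -/
theorem farFromNode_of_re_le_im {h s : ℝ} {z : ℂ} (hh : 0 < h) (hx : 0 ≤ z.re)
    (hxy : z.re ≤ z.im) (hs : h ≤ s) : FarFromNode h z s := by
  have hs0 : 0 < s := hh.trans_le hs
  have hsq : ‖z ^ 2 - (s : ℂ) ^ 2‖ ^ 2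
      = (‖z‖ ^ 2) ^ 2 + s ^ 4 + 2 * s ^ 2 * (z.im ^ 2 - z.re ^ 2) := by
    rw [Complex.sq_norm, Complex.sq_norm, Complex.normSq_apply, Complex.normSq_apply]
    simp [pow_two]
    ring
  have hxy2 : 0 ≤ 2 * s ^ 2 * (z.im ^ 2 - z.re ^ 2) :=
    mul_nonneg (by positivity) (by nlinarith)
  have h1 : ‖z‖ ^ 2 ≤ ‖z ^ 2 - (s : ℂ) ^ 2‖ := by
    refine le_of_sq_le_sq ?_ (norm_nonneg _)
    rw [hsq]; nlinarith [sq_nonneg (s ^ 2)]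
  have h2 : s * ‖z‖ ≤ ‖z ^ 2 - (s : ℂ) ^ 2‖ := by
    refine le_of_sq_le_sq ?_ (norm_nonneg _)
    rw [hsq]; nlinarith [sq_nonneg (s ^ 2 - ‖z‖ ^ 2), sq_nonneg (s * ‖z‖)]
  constructor
  · rw [div_mul_eq_mul_div, le_div_iff₀ hh]
    nlinarith [norm_nonneg z, norm_nonneg (z ^ 2 - (s : ℂ) ^ 2)]
  · refine h1.trans (le_mul_of_one_le_left (norm_nonneg _) ?_)
    have : 0 ≤ 4 / h * s := by positivity
    linarith

/-- Factor `z² - s² = (z - s)(z + s)` and use `|z + s| ≥ |z|`, `|z - s| ≥ h / 4` and `|z| ≤ |z - s|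
+ s`. -/
theorem farFromNode_of_dist {h s : ℝ} {z : ℂ} (hh : 0 < h) (hx : 0 ≤ z.re) (hs : 0 ≤ s)
    (hd : h / 4 ≤ ‖z - s‖) : FarFromNode h z s := by
  have hfac : ‖z ^ 2 - (s : ℂ) ^ 2‖ = ‖z - s‖ * ‖z + s‖ := by rw [← norm_mul]; ring_nf
  have h1 : ‖z‖ ≤ ‖z + s‖ := by
    rw [← sq_le_sq₀ (norm_nonneg _) (norm_nonneg _), Complex.sq_norm, Complex.sq_norm,
      Complex.normSq_apply, Complex.normSq_apply]
    simp
    nlinarith [mul_nonneg hx hs]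
  have h2 : 1 ≤ 4 / h * ‖z - s‖ := by
    rw [div_mul_eq_mul_div, le_div_iff₀ hh]; linarith
  have h3 : ‖z‖ ≤ ‖z - s‖ + s := by
    have := norm_add_le (z - s) (s : ℂ)
    rwa [sub_add_cancel, Complex.norm_real, norm_of_nonneg hs] at this
  constructor
  · rw [hfac, ← mul_assoc]
    exact h1.trans (le_mul_of_one_le_left (norm_nonneg _) h2)
  · have h4 : ‖z‖ ≤ (1 + 4 / h * s) * ‖z - s‖ := by
      nlinarith [mul_le_mul_of_nonneg_right h2 hs]
    rw [hfac, ← mul_assoc, pow_two]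
    exact mul_le_mul h4 h1 (norm_nonneg _) ((norm_nonneg _).trans h4)

theorem norm_integrand_le {h s : ℝ} {z : ℂ} (hh : 0 < h) (hs : 0 ≤ s) (hf : FarFromNode h z s) :
    2 * h * ‖integrand z s‖ ≤ 8 / π * exp (-s ^ 2) ∧
    (1 + √π * ‖z‖) * (2 * h * ‖integrand z s‖)
      ≤ (8 / π + 2 / π * (√π * h)) * exp (-s ^ 2) + 8 / √π * (s * exp (-s ^ 2)) := by
  have hn : ‖integrand z s‖ = exp (-s ^ 2) * (‖z‖ / (π * ‖z ^ 2 - (s : ℂ) ^ 2‖)) := by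
    rw [integrand, norm_mul, norm_div, norm_mul, norm_mul, Complex.norm_I, Complex.norm_exp,
      Complex.norm_real, norm_of_nonneg pi_pos.le, one_mul]
    congr 2
    rw [← Complex.ofReal_pow, ← Complex.ofReal_neg, Complex.ofReal_re]
  rw [hn]
  obtain ⟨h1, h2⟩ := hf
  set D := ‖z ^ 2 - (s : ℂ) ^ 2‖
  have hD : 0 ≤ D := norm_nonneg _
  have hp : √π * √π = π := mul_self_sqrt pi_pos.le
  have hs8 : 8 / √π = 8 / π * √π := by
    rw [div_mul_eq_mul_div, div_eq_div_iff (by positivity) (by positivity)]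
    linear_combination -8 * hp
  rcases hD.eq_or_lt with h0 | h0
  -- A vanishing denominator makes the quotient 0 by the convention for division.
  · rw [← h0]
    simp only [mul_zero, div_zero]
    constructor <;> positivity
  have h3 : ‖z‖ / D ≤ 4 / h := by rwa [div_le_iff₀ h0]
  have h4 : ‖z‖ * (‖z‖ / D) ≤ 1 + 4 / h * s := by
    rwa [mul_div_assoc', ← pow_two, div_le_iff₀ h0]
  have h5 : ‖z‖ / (π * D) = 1 / π * (‖z‖ / D) := by field_simp
  rw [h5, hs8]
  have he := exp_pos (-s ^ 2)
  constructor
  · calc 2 * h * (exp (-s ^ 2) * (1 / π * (‖z‖ / D)))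
        ≤ 2 * h * (exp (-s ^ 2) * (1 / π * (4 / h))) := by gcongr
      _ = _ := by field_simp; norm_num
  · calc (1 + √π * ‖z‖) * (2 * h * (exp (-s ^ 2) * (1 / π * (‖z‖ / D))))
        = 2 * h / π * exp (-s ^ 2) * (‖z‖ / D + √π * (‖z‖ * (‖z‖ / D))) := by ring
      _ ≤ 2 * h / π * exp (-s ^ 2) * (4 / h + √π * (1 + 4 / h * s)) := by gcongr
      _ = _ := by field_simp; ring

theorem mul_exp_neg_sq_anti {s t : ℝ} (hs : 1 ≤ s) (hst : s ≤ t) :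
    t * exp (-t ^ 2) ≤ s * exp (-s ^ 2) := by
  have h1 : t ≤ s * exp (t ^ 2 - s ^ 2) := by
    have := add_one_le_exp (t ^ 2 - s ^ 2)
    nlinarith [mul_le_mul_of_nonneg_left this (by linarith : 0 ≤ s), mul_nonneg
      (sub_nonneg.2 hst) (by linarith : 0 ≤ t + s - 1)]
  calc t * exp (-t ^ 2) ≤ s * exp (t ^ 2 - s ^ 2) * exp (-t ^ 2) := by gcongr
    _ = s * (exp (t ^ 2 - s ^ 2) * exp (-t ^ 2)) := by ring
    _ = s * exp (-s ^ 2) := by rw [← exp_add]; ring_nf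

theorem node_tail_bounds {α : ℝ} (hα : 0 ≤ α) (N j : ℕ) :
    exp (-node (step N) α (j + (N + 1)) ^ 2) ≤ exp (-(π / step N) ^ 2) * (1 / 100) ^ j ∧
    node (step N) α (j + (N + 1)) * exp (-node (step N) α (j + (N + 1)) ^ 2)
      ≤ π / step N * exp (-(π / step N) ^ 2) * (1 / 100) ^ j := by
  have hh := step_pos N
  have hj : (0 : ℝ) ≤ j := by positivity
  set b := π / step N with hb
  have hbh : b = (N + 1) * step N := pi_div_step N
  have hb1 : 1 ≤ b := one_le_pi_div_step N
  set s := node (step N) α (j + (N + 1)) with hs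
  -- The comparison point drops the shift `α`. Since `b h = π`, `t² ≥ b² + 2 j π`, so the decay per
  -- node does not depend on `N`.
  set t := b + j * step N with ht
  have hts : t ≤ s := by
    rw [ht, hs, hbh, node]
    push_cast
    nlinarith [mul_nonneg hα hh.le]
  have ht1 : 1 ≤ t := by have : 0 ≤ j * step N := by positivity
                         linarith
  have hbj : b * step N = π := by rw [hb]; field_simp
  have het : exp (-t ^ 2) ≤ exp (-b ^ 2) * (1 / 400) ^ j := by
    refine le_trans ?_ (mul_le_mul_of_nonneg_left (exp_neg_two_mul_le le_rfl j) (exp_pos _).le)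
    rw [← exp_add]
    refine exp_le_exp.2 ?_
    rw [ht]
    nlinarith [sq_nonneg ((j : ℝ) * step N)]
  constructor
  · calc exp (-s ^ 2) ≤ exp (-t ^ 2) := exp_le_exp.2 (by nlinarith)
      _ ≤ exp (-b ^ 2) * (1 / 400) ^ j := het
      _ ≤ _ := by gcongr; norm_num
  · have htb : t ≤ b * (j + 1) := by
      have : step N ≤ b := by
        rw [hbh]; nlinarith [mul_nonneg (Nat.cast_nonneg (α := ℝ) N) hh.le]
      nlinarith
    calc s * exp (-s ^ 2) ≤ t * exp (-t ^ 2) := mul_exp_neg_sq_anti ht1 hts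
      _ ≤ (b * (j + 1)) * (exp (-b ^ 2) * (1 / 400) ^ j) := by gcongr
      _ = b * exp (-b ^ 2) * ((j + 1) * (1 / 400) ^ j) := by ring
      _ ≤ _ := by gcongr; exact add_one_mul_pow_le j

/-- The constants round up `(8 / π) · 100 / 99` and `(8 / π + 2 + 8) · 100 / 99`, using `√(N + 1) ≥
1`. -/
theorem norm_tail_le {α : ℝ} (hα : 0 ≤ α) (N : ℕ) {z : ℂ}
    (hf : ∀ k : ℕ, N + 1 ≤ k → FarFromNode (step N) z (node (step N) α k)) :
    ‖tail (step N) α N z‖ ≤ 2.6 * exp (-(π / step N) ^ 2) ∧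
    (1 + √π * ‖z‖) * ‖tail (step N) α N z‖
      ≤ 13 * √((N : ℝ) + 1) * exp (-(π / step N) ^ 2) := by
  have hh := step_pos N
  set b := π / step N with hb
  have hn : ∀ j : ℕ, 0 ≤ node (step N) α (j + (N + 1)) := fun j => by
    unfold node; positivity
  have ht : tail (step N) α N z
      = ∑' j : ℕ, 2 * (step N : ℂ) * integrand z (node (step N) α (j + (N + 1))) := by
    rw [tail, tsum_mul_left]
  have hnorm : ∀ j : ℕ, ‖2 * (step N : ℂ) * integrand z (node (step N) α (j + (N + 1)))‖
      = 2 * step N * ‖integrand z (node (step N) α (j + (N + 1)))‖ := fun j => by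
    rw [norm_mul, norm_mul, Complex.norm_real, norm_of_nonneg hh.le]
    norm_num
  have hpi : 8 / π ≤ 2.55 := by
    rw [div_le_iff₀ pi_pos]; linarith [pi_gt_d4]
  have hσ := one_le_sqrt_add_one N
  have he := exp_pos (-b ^ 2)
  rw [ht]
  constructor
  · have := mul_norm_tsum_le (L := 1) (C := 8 / π * exp (-b ^ 2)) (q := 1 / 100) one_pos
      (by norm_num) (by norm_num) fun j => by
        rw [one_mul, hnorm, mul_assoc (8 / π)]
        refine (norm_integrand_le hh (hn j) (hf _ (by omega))).1.trans ?_
        gcongr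
        exact (node_tail_bounds hα N j).1
    rw [one_mul] at this
    refine this.trans ?_
    have h1 : (1 - 1 / 100 : ℝ)⁻¹ = 100 / 99 := by norm_num
    rw [h1]
    nlinarith [mul_le_mul_of_nonneg_right hpi he.le]
  · have := mul_norm_tsum_le (L := 1 + √π * ‖z‖)
      (C := (8 / π + 2) * exp (-b ^ 2) + 8 / √π * (b * exp (-b ^ 2))) (q := 1 / 100)
      (by positivity) (by norm_num) (by norm_num) fun j => by
        rw [hnorm]
        refine (norm_integrand_le hh (hn j) (hf _ (by omega))).2.trans ?_
        obtain ⟨h1, h2⟩ := node_tail_bounds hα N j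
        have h3 : 2 / π * (√π * step N) ≤ 2 := by
          rw [div_mul_eq_mul_div, div_le_iff₀ pi_pos]
          linarith [sqrt_pi_mul_step_le N]
        calc _ ≤ (8 / π + 2) * (exp (-b ^ 2) * (1 / 100) ^ j)
              + 8 / √π * (b * exp (-b ^ 2) * (1 / 100) ^ j) := by gcongr
          _ = _ := by ring
    refine this.trans ?_
    have h1 : (1 - 1 / 100 : ℝ)⁻¹ = 100 / 99 := by norm_num
    have h2 : 8 / √π * b = 8 * √((N : ℝ) + 1) := by
      have hp : √π * √π = π := mul_self_sqrt pi_pos.le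
      have h3 := sqrt_pi_mul_pi_div_step N
      rw [← hb] at h3
      rw [div_mul_eq_mul_div, div_eq_iff (by positivity)]
      have h4 : √π * (√π * √((N : ℝ) + 1)) = √π * b := by rw [h3, ← mul_assoc, hp]
      linear_combination -8 * mul_left_cancel₀ (by positivity : √π ≠ 0) h4
    rw [h1, ← mul_assoc (8 / √π), h2]
    nlinarith [mul_le_mul_of_nonneg_right hpi he.le, mul_le_mul_of_nonneg_right hσ he.le]

/-! ### Size of the correction for `b ≤ Im z ≤ Re z`. -/

theorem norm_correction_le {h α : ℝ} (hh : 0 < h) (hb2 : π ≤ (π / h) ^ 2) {z : ℂ}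
    (hy : π / h ≤ z.im) (hxy : z.im ≤ z.re) :
    ‖correction h α z‖ ≤ 4 * exp (-(2 * (π / h) * z.re)) := by
  set b := π / h with hb
  have hb0 : 0 < b := div_pos pi_pos hh
  set E := Complex.exp (-(2 * Complex.I * (π : ℂ) * ((α : ℂ) + z / (h : ℂ))))
  have hE : ‖E‖ = exp (2 * b * z.im) := by
    rw [Complex.norm_exp]
    congr 1
    have : -(2 * Complex.I * (π : ℂ) * ((α : ℂ) + z / (h : ℂ)))
        = ((-2 * π * α : ℝ) : ℂ) * Complex.I + ((-2 * b : ℝ) : ℂ) * (Complex.I * z) := by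
      rw [hb]; push_cast; ring
    rw [this, Complex.add_re, Complex.re_ofReal_mul, Complex.re_ofReal_mul]
    simp
  have hE2 : 2 ≤ exp (2 * b * z.im) := by
    have := add_one_le_exp (2 * b * z.im)
    nlinarith [mul_le_mul_of_nonneg_left hy hb0.le, pi_gt_three]
  have h1 : exp (2 * b * z.im) / 2 ≤ ‖1 - E‖ := by
    have := norm_sub_norm_le E 1
    rw [norm_sub_rev, hE, norm_one] at this
    linarith
  have h2 : ‖Complex.exp (-z ^ 2)‖ = exp (z.im ^ 2 - z.re ^ 2) := by
    rw [Complex.norm_exp]; congr 1; simp [pow_two]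
  rw [correction, norm_div, norm_mul, h2]
  have h3 : ‖(2 : ℂ)‖ = 2 := by norm_num
  rw [h3]
  calc 2 * exp (z.im ^ 2 - z.re ^ 2) / ‖1 - E‖
      ≤ 2 * exp (z.im ^ 2 - z.re ^ 2) / (exp (2 * b * z.im) / 2) := by gcongr
    _ = 4 * exp (z.im ^ 2 - z.re ^ 2 - 2 * b * z.im) := by
      rw [exp_sub _ (2 * b * z.im)]; field_simp; norm_num
    _ ≤ _ := by
      gcongr
      -- With `x = Re z` and `y = Im z`, the inequality `y² - x² - 2 b y ≤ -2 b x` is `(x - y)(x + y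
      -- - 2 b) ≥ 0`.
      nlinarith [mul_nonneg (sub_nonneg.2 hxy) (by linarith : 0 ≤ z.im + z.re - 2 * b)]

theorem correction_bounds {h α : ℝ} (hh : 0 < h) (hb2 : π ≤ (π / h) ^ 2) {z : ℂ}
    (hy : π / h ≤ z.im) (hxy : z.im ≤ z.re) :
    ‖correction h α z‖ ≤ 4 * exp (-(π / h) ^ 2) ∧
    (1 + √π * ‖z‖) * ‖correction h α z‖ ≤ 8 * exp (-(π / h) ^ 2) := by
  have h0 := norm_correction_le (α := α) hh hb2 hy hxy
  set b := π / h with hb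
  have hb0 : 0 < b := div_pos pi_pos hh
  have hsb : √π ≤ b := sqrt_le_iff.2 ⟨hb0.le, hb2⟩
  have h1 : exp (-(2 * b * z.re)) ≤ exp (-b ^ 2) * exp (-(b * z.re)) := by
    rw [← exp_add]
    refine exp_le_exp.2 ?_
    nlinarith [mul_le_mul_of_nonneg_left (hy.trans hxy) hb0.le]
  have hbx : 0 ≤ b * z.re := by
    have : b ≤ z.re := hy.trans hxy
    exact mul_nonneg hb0.le (hb0.le.trans this)
  have h2 : exp (-(b * z.re)) ≤ 1 := exp_le_one_iff.2 (by linarith)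
  have he := exp_pos (-b ^ 2)
  constructor
  · refine h0.trans ?_
    nlinarith
  · have hx0 : 0 ≤ z.re := by linarith
    have hn : ‖z‖ ≤ 2 * z.re := by
      have := Complex.norm_le_abs_re_add_abs_im z
      rw [abs_of_nonneg hx0, abs_of_nonneg (by linarith)] at this
      linarith
    have h3 : (1 + b * z.re) * exp (-(b * z.re)) ≤ 1 := by
      have := add_one_le_exp (b * z.re)
      calc (1 + b * z.re) * exp (-(b * z.re)) ≤ exp (b * z.re) * exp (-(b * z.re)) := by
            gcongr; linarith
        _ = 1 := by rw [← exp_add]; simp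
    have h4 : 1 + √π * ‖z‖ ≤ 2 * (1 + b * z.re) := by
      have : √π * ‖z‖ ≤ b * (2 * z.re) := by gcongr
      linarith
    calc (1 + √π * ‖z‖) * ‖correction h α z‖
        ≤ (2 * (1 + b * z.re)) * (4 * (exp (-b ^ 2) * exp (-(b * z.re)))) := by
          gcongr
          exact h0.trans (by gcongr)
      _ = 8 * exp (-b ^ 2) * ((1 + b * z.re) * exp (-(b * z.re))) := by ring
      _ ≤ 8 * exp (-b ^ 2) * 1 := by gcongr
      _ = _ := mul_one _

/-! ### Numerical constants and assembly of the error bounds. -/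

/-- The second summand alone is large enough; the first is only used to be nonnegative. -/
theorem C₁_lower : 10 * exp (-π) ≤ C₁ := by
  have h0 : 0 ≤ 1 - exp (-2 * π + √(2 * π)) := by
    have : √(2 * π) ≤ 2 * π := sqrt_le_self_iff.2 (Or.inr (by linarith [pi_gt_three]))
    rw [sub_nonneg, exp_le_one_iff]
    linarith
  have h1 : 0 ≤ 2 * (2 * exp 1 + √π) /
      (exp π * √(exp 1 * π) * (1 - exp (-2 * π + √(2 * π)))) := by positivity
  have h2 : 10 * exp (-π) ≤ 10 * √2 * (1 + 2 * π) / (exp π * π ^ 2) := by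
    rw [exp_neg, le_div_iff₀ (by positivity)]
    have hs : 1.41 ≤ √2 := by apply le_sqrt_of_sq_le; norm_num
    have : 10 * (exp π)⁻¹ * (exp π * π ^ 2) = 10 * π ^ 2 := by field_simp
    rw [this]
    nlinarith [pi_gt_d2, pi_lt_d2]
  rw [C₁]
  linarith

/-- The two summands contribute at least `20 exp (-π)` and `55 exp (-π)`. The target covers the `74
= 2 · 37` that arises in `ErrorBound.bounds`. -/
theorem C₂_lower : 75 * exp (-π) ≤ C₂ := by
  have h0 : 0 < 1 - exp (-2 * π + √(2 * π)) := by
    have : √(2 * π) < 2 * π := by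
      rw [sqrt_lt' (by positivity)]; nlinarith [pi_gt_three]
    rw [sub_pos, exp_lt_one_iff]
    linarith
  have hs : 1.41 ≤ √2 := by apply le_sqrt_of_sq_le; norm_num
  have hsp : 1.7 ≤ √π := by apply le_sqrt_of_sq_le; linarith [pi_gt_d2]
  have hse : 1.6 ≤ √(exp 1) := by apply le_sqrt_of_sq_le; linarith [exp_one_gt_d9]
  have hee : √(exp 1) * √(exp 1) = exp 1 := mul_self_sqrt (exp_pos _).le
  have h1 : 20 * exp (-π) ≤ 2 * √2 * (1 + √π) * (2 * exp 1 + √π) /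
      (exp π * √(exp 1) * (1 - exp (-2 * π + √(2 * π)))) := by
    rw [exp_neg, le_div_iff₀ (by positivity)]
    have h2 : 20 * (exp π)⁻¹ * (exp π * √(exp 1) * (1 - exp (-2 * π + √(2 * π))))
        = 20 * √(exp 1) * (1 - exp (-2 * π + √(2 * π))) := by field_simp
    rw [h2]
    calc 20 * √(exp 1) * (1 - exp (-2 * π + √(2 * π))) ≤ 20 * √(exp 1) * 1 := by
          gcongr; linarith [exp_pos (-2 * π + √(2 * π))]
      _ ≤ 2 * 1.41 * (1 + 1.7) * (2 * (1.6 * √(exp 1)) + 0) := by linarith [sqrt_nonneg (exp 1)]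
      _ ≤ 2 * √2 * (1 + √π) * (2 * exp 1 + √π) := by
          gcongr
          · exact (mul_le_mul_of_nonneg_right hse (sqrt_nonneg _)).trans_eq hee
          · positivity
  have h2 : 55 * exp (-π) ≤ 10 * (1 + 2 * π) * (2 * π + √2) / (exp π * π ^ 2) := by
    rw [exp_neg, le_div_iff₀ (by positivity)]
    have : 55 * (exp π)⁻¹ * (exp π * π ^ 2) = 55 * π ^ 2 := by field_simp
    rw [this]
    nlinarith [pi_gt_d2, pi_lt_d2]
  rw [C₂]
  linarith

/-- The absolute error bound, and the error bound weighted by `1 + √π |z|`. -/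
def ErrorBound (N : ℕ) (z A : ℂ) : Prop :=
  ‖w z - A‖ ≤ 10 * exp (-(π / step N) ^ 2) ∧
    (1 + √π * ‖z‖) * ‖w z - A‖ ≤ 37 * √((N : ℝ) + 1) * exp (-(π / step N) ^ 2)

theorem w_ne_zero {z : ℂ} (hx : 0 ≤ z.re) (hy : 0 ≤ z.im) : w z ≠ 0 := by
  intro h0
  have := one_le_mul_norm_w hx hy
  rw [h0, norm_zero, mul_zero] at this
  linarith

theorem ErrorBound.bounds {N : ℕ} {z A : ℂ} (hA : ErrorBound N z A) (hx : 0 ≤ z.re)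
    (hy : 0 ≤ z.im) : w z ≠ 0 ∧ ‖w z - A‖ ≤ C₁ * exp (-π * N) ∧
      ‖w z - A‖ / ‖w z‖ ≤ C₂ * √((N : ℝ) + 1) * exp (-π * N) := by
  obtain ⟨h1, h2⟩ := hA
  have hw := w_ne_zero hx hy
  rw [exp_neg_pi_div_step_sq] at h1 h2
  refine ⟨hw, h1.trans ?_, ?_⟩
  · rw [← mul_assoc]
    gcongr
    exact C₁_lower
  · rw [div_le_iff₀ (norm_pos_iff.2 hw)]
    have h3 := one_le_mul_norm_w hx hy
    calc ‖w z - A‖ = ‖w z - A‖ * 1 := (mul_one _).symm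
      -- The lower bound on `|w z|` trades the relative error for the weighted absolute error.
      _ ≤ ‖w z - A‖ * (2 * (1 + √π * ‖z‖) * ‖w z‖) := by gcongr
      _ = 2 * ((1 + √π * ‖z‖) * ‖w z - A‖) * ‖w z‖ := by ring
      _ ≤ 2 * (37 * √((N : ℝ) + 1) * (exp (-π) * exp (-π * N))) * ‖w z‖ := by gcongr
      _ = 74 * exp (-π) * √((N : ℝ) + 1) * exp (-π * N) * ‖w z‖ := by ring
      _ ≤ C₂ * √((N : ℝ) + 1) * exp (-π * N) * ‖w z‖ := by
        gcongr
        linarith [C₂_lower, exp_pos (-π)]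

theorem alpha_nonneg {α : ℝ} (hα : α = 0 ∨ α = 1 / 2) : 0 ≤ α := by
  rcases hα with rfl | rfl <;> norm_num

theorem errorBound_rawModApprox_of_im_le {α : ℝ} (hα : α = 0 ∨ α = 1 / 2) {N : ℕ} {z : ℂ}
    (hz : 0 < z.im) (hb : z.im ≤ π / step N)
    (hf : ∀ k : ℕ, N + 1 ≤ k → FarFromNode (step N) z (node (step N) α k)) :
    ErrorBound N z (rawModApprox (step N) α N z) := by
  have hh := step_pos N
  rw [ErrorBound, w_sub_rawModApprox hh hα N hz]
  obtain ⟨t1, t2⟩ := norm_tail_le (alpha_nonneg hα) N hf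
  obtain ⟨p1, p2⟩ := norm_tsum_dualTerm_pos (α := α) (div_pos pi_pos hh)
    (pi_le_pi_div_step_sq N) hz.le
  obtain ⟨r1, r2⟩ := norm_tsum_reflectedTerm (α := α) (div_pos pi_pos hh)
    (pi_le_pi_div_step_sq N) hb
  rw [sqrt_pi_mul_pi_div_step] at r2
  set T := tail (step N) α N z
  set P := ∑' j : ℕ, dualTerm (π / step N) α z ((j : ℤ) + 1)
  set R := ∑' j : ℕ, reflectedTerm (π / step N) α z j
  have htri : ‖T - P + R‖ ≤ ‖T‖ + ‖P‖ + ‖R‖ :=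
    (norm_add_le _ _).trans (by gcongr; exact norm_sub_le _ _)
  have he := exp_pos (-(π / step N) ^ 2)
  set e := exp (-(π / step N) ^ 2)
  have hσ := one_le_sqrt_add_one N
  set σ := √((N : ℝ) + 1)
  constructor
  · linarith
  · have h1 : (1 + √π * ‖z‖) * ‖T - P + R‖ ≤ (1 + √π * ‖z‖) * (‖T‖ + ‖P‖ + ‖R‖) := by gcongr
    have h2 : e ≤ σ * e := le_mul_of_one_le_left he.le hσ
    have h3 : π * (σ * e) ≤ 3.15 * (σ * e) := by gcongr; exact pi_lt_d2.le
    nlinarith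

/-- The constants are sharper than in `ErrorBound` so that the correction, of size at most 4 and 8
in the same units, still fits: `5.7 + 4 ≤ 10` and `28 + 8 ≤ 37`. -/
theorem errorBound_truncApprox {α : ℝ} (hα : α = 0 ∨ α = 1 / 2) {N : ℕ} {z : ℂ}
    (hb : π / step N ≤ z.im)
    (hf : ∀ k : ℕ, N + 1 ≤ k → FarFromNode (step N) z (node (step N) α k)) :
    ‖w z - truncApprox (step N) α N z‖ ≤ 5.7 * exp (-(π / step N) ^ 2) ∧
    (1 + √π * ‖z‖) * ‖w z - truncApprox (step N) α N z‖
      ≤ 28 * √((N : ℝ) + 1) * exp (-(π / step N) ^ 2) := by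
  have hh := step_pos N
  have hz : 0 < z.im := (div_pos pi_pos hh).trans_le hb
  rw [w_sub_truncApprox hh hα N hz]
  obtain ⟨t1, t2⟩ := norm_tail_le (alpha_nonneg hα) N hf
  obtain ⟨p1, p2⟩ := norm_tsum_dualTerm_pos (α := α) (div_pos pi_pos hh)
    (pi_le_pi_div_step_sq N) hz.le
  obtain ⟨r1, r2⟩ := norm_tsum_dualTerm_neg (α := α) (div_pos pi_pos hh)
    (pi_le_pi_div_step_sq N) hb
  rw [sqrt_pi_mul_pi_div_step] at r2
  set T := tail (step N) α N z
  set P := ∑' j : ℕ, dualTerm (π / step N) α z ((j : ℤ) + 1)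
  set R := ∑' j : ℕ, dualTerm (π / step N) α z (-((j : ℤ) + 1))
  have htri : ‖T - P - R‖ ≤ ‖T‖ + ‖P‖ + ‖R‖ :=
    (norm_sub_le _ _).trans (by gcongr; exact norm_sub_le _ _)
  have he := exp_pos (-(π / step N) ^ 2)
  set e := exp (-(π / step N) ^ 2)
  have hσ := one_le_sqrt_add_one N
  set σ := √((N : ℝ) + 1)
  constructor
  · linarith
  · have h1 : (1 + √π * ‖z‖) * ‖T - P - R‖ ≤ (1 + √π * ‖z‖) * (‖T‖ + ‖P‖ + ‖R‖) := by gcongr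
    have h2 : e ≤ σ * e := le_mul_of_one_le_left he.le hσ
    have h3 : π * (σ * e) ≤ 3.15 * (σ * e) := by gcongr; exact pi_lt_d2.le
    nlinarith

theorem errorBound_rawModApprox_of_le_im {α : ℝ} (hα : α = 0 ∨ α = 1 / 2) {N : ℕ} {z : ℂ}
    (hb : π / step N ≤ z.im) (hxy : z.im ≤ z.re)
    (hf : ∀ k : ℕ, N + 1 ≤ k → FarFromNode (step N) z (node (step N) α k)) :
    ErrorBound N z (rawModApprox (step N) α N z) := by
  obtain ⟨t1, t2⟩ := errorBound_truncApprox hα hb hf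
  obtain ⟨c1, c2⟩ := correction_bounds (α := α) (step_pos N) (pi_le_pi_div_step_sq N) hb hxy
  rw [ErrorBound, rawModApprox, ← sub_sub]
  have htri := norm_sub_le (w z - truncApprox (step N) α N z) (correction (step N) α z)
  have he := exp_pos (-(π / step N) ^ 2)
  have hσ := one_le_sqrt_add_one N
  constructor
  · linarith
  · have h1 := mul_le_mul_of_nonneg_left htri (by positivity : 0 ≤ 1 + √π * ‖z‖)
    have h2 := le_mul_of_one_le_left he.le hσ
    linarith

/-! ### Removable singularities at the retained nodes. -/

/-- Writing `D z = (z - s) · dslope D s z`, the difference is the slope at `s` of `n / dslope D s`,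
so it tends to a derivative. -/
theorem exists_tendsto_div_sub_pole {n D : ℂ → ℂ} {s d : ℂ} (hn : Differentiable ℂ n)
    (hD : Differentiable ℂ D) (hs : D s = 0) (hd : HasDerivAt D d s) (hd0 : d ≠ 0) :
    ∃ c, Tendsto (fun z => n z / D z - n s / d / (z - s)) (𝓝[≠] s) (𝓝 c) := by
  have hδ : Differentiable ℂ (dslope D s) := by
    rw [← differentiableOn_univ, Complex.differentiableOn_dslope univ_mem]
    exact hD.differentiableOn
  have hδs : dslope D s s = d := by rw [dslope_same, hd.deriv]
  have hg : DifferentiableAt ℂ (fun z => n z / dslope D s z) s :=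
    (hn s).div (hδ s) (by rwa [hδs])
  refine ⟨_, (hasDerivAt_iff_tendsto_slope.1 hg.hasDerivAt).congr' ?_⟩
  filter_upwards [self_mem_nhdsWithin] with z hz
  have hz0 : z - s ≠ 0 := sub_ne_zero.2 hz
  have h1 : D z = (z - s) * dslope D s z := by
    rw [← smul_eq_mul, sub_smul_dslope, hs, sub_zero]
  rw [slope_def_field, hδs, h1]
  field_simp

/-- The quadrature weights of `truncRule`. -/
def weight (h α : ℝ) (k : ℕ) : ℂ := if α = 0 ∧ k = 0 then h else 2 * h

theorem truncApprox_eq_sum {α : ℝ} (h : ℝ) (N : ℕ) (z : ℂ) :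
    truncApprox h α N z
      = ∑ k ∈ Finset.range (N + 1), weight h α k * integrand z (node h α k) := by
  rw [truncApprox, truncRule]
  split_ifs with h0
  · subst h0
    rw [Finset.sum_range_succ', add_comm]
    have e2 : ∑ k ∈ Finset.range N, integrand z (node h 0 (k + 1))
        = ∑ k ∈ Finset.Icc 1 N, integrand z (node h 0 k) := by
      rw [Finset.range_eq_Ico, Finset.sum_Ico_add' (fun k => integrand z (node h 0 k)) 0 N 1]
      rfl
    rw [← e2, Finset.mul_sum]
    simp [weight, node]
  · simp [weight, h0, Finset.mul_sum]

theorem continuousAt_integrand {z : ℂ} {s : ℝ} (hz : z ^ 2 - (s : ℂ) ^ 2 ≠ 0) :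
    ContinuousAt (fun z => integrand z s) z := by
  have hpc : (π : ℂ) ≠ 0 := by exact_mod_cast pi_pos.ne'
  unfold integrand
  refine continuousAt_const.mul (ContinuousAt.div (by fun_prop) (by fun_prop) ?_)
  exact mul_ne_zero hpc hz

theorem sq_sub_sq_ne_zero {z : ℂ} {s : ℝ} (hx : 0 ≤ z.re) (hs : 0 ≤ s) (hne : z ≠ s) :
    z ^ 2 - (s : ℂ) ^ 2 ≠ 0 := by
  have : z ^ 2 - (s : ℂ) ^ 2 = (z - s) * (z + s) := by ring
  rw [this]
  refine mul_ne_zero (sub_ne_zero.2 hne) fun h0 => hne ?_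
  have hz : z = -s := eq_neg_of_add_eq_zero_left h0
  have hre := congrArg Complex.re hz
  simp only [Complex.neg_re, Complex.ofReal_re] at hre
  have : s = 0 := by linarith
  rw [hz, this]
  simp

theorem node_nonneg {h α : ℝ} (hh : 0 < h) (hα : 0 ≤ α) (k : ℕ) : 0 ≤ node h α k := by
  unfold node; positivity

/-- Solving `α + z / h = -m` gives `z = (-m - α) h`. The node index is `-m` for `α = 0` and `-m - 1`
for `α = 1/2`, nonnegative because `Re z ≥ 0`. -/
theorem exists_node_eq_of_exp_eq_one {h α : ℝ} (hh : 0 < h) (hα : α = 0 ∨ α = 1 / 2) {z : ℂ}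
    (hx : 0 ≤ z.re)
    (h1 : Complex.exp (-(2 * Complex.I * (π : ℂ) * ((α : ℂ) + z / (h : ℂ)))) = 1) :
    ∃ k : ℕ, z = node h α k := by
  have hc : (h : ℂ) ≠ 0 := by exact_mod_cast hh.ne'
  have hpc : (π : ℂ) ≠ 0 := by exact_mod_cast pi_pos.ne'
  obtain ⟨m, hm⟩ := Complex.exp_eq_one_iff.1 h1
  have h2 : (α : ℂ) + z / h = -m := by
    have h3 : (2 * π * Complex.I) * ((α : ℂ) + z / h) = (2 * π * Complex.I) * -m := by
      linear_combination -hm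
    exact mul_left_cancel₀ (by simp [pi_pos.ne']) h3
  have h4 : z = (((-m : ℝ) - α) * h : ℝ) := by
    have : z = (-m - α) * h := by
      rw [← h2]; field_simp; ring
    rw [this]; push_cast; rfl
  have h5 : 0 ≤ (-m : ℝ) - α := by
    rw [h4, Complex.ofReal_re] at hx
    exact nonneg_of_mul_nonneg_left hx hh
  rcases hα with rfl | rfl
  · have h6 : 0 ≤ -m := by
      have : (0 : ℝ) ≤ ((-m : ℤ) : ℝ) := by push_cast; linarith
      exact_mod_cast this
    obtain ⟨k, hk⟩ := Int.eq_ofNat_of_zero_le h6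
    refine ⟨k, ?_⟩
    have hk' : (-m : ℝ) = k := by exact_mod_cast hk
    rw [h4, node, hk']; simp
  · have h6 : 0 ≤ -m - 1 := by
      have h7 : (0 : ℝ) < ((-m : ℤ) : ℝ) := by push_cast; linarith
      have h8 : 0 < -m := by exact_mod_cast h7
      omega
    obtain ⟨k, hk⟩ := Int.eq_ofNat_of_zero_le h6
    refine ⟨k, ?_⟩
    have hk' : (-m : ℝ) - 1 = k := by exact_mod_cast hk
    rw [h4, node, ← hk']
    congr 2
    ring

theorem exp_node_eq_one {h α : ℝ} (hh : 0 < h) (hα : α = 0 ∨ α = 1 / 2) (k : ℕ) :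
    Complex.exp (-(2 * Complex.I * (π : ℂ) * ((α : ℂ) + (node h α k : ℂ) / (h : ℂ)))) = 1 := by
  have hc : (h : ℂ) ≠ 0 := by exact_mod_cast hh.ne'
  rw [Complex.exp_eq_one_iff]
  rcases hα with rfl | rfl
  · refine ⟨-k, ?_⟩
    rw [node]; push_cast; field_simp; ring
  · refine ⟨-(k + 1), ?_⟩
    rw [node]; push_cast; field_simp; ring

theorem continuousAt_rawModApprox {h α : ℝ} (hh : 0 < h) (hα : α = 0 ∨ α = 1 / 2) (N : ℕ) {z : ℂ}
    (hx : 0 ≤ z.re) (hne : ∀ k : ℕ, z ≠ node h α k) : ContinuousAt (rawModApprox h α N) z := by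
  have h1 : ContinuousAt (truncApprox h α N) z := by
    rw [funext (truncApprox_eq_sum (α := α) h N)]
    refine tendsto_finsetSum _ fun k _ => ?_
    exact (continuousAt_integrand (sq_sub_sq_ne_zero hx (node_nonneg hh (alpha_nonneg hα) k)
      (hne k))).const_mul _
  refine h1.add ?_
  unfold correction
  refine ContinuousAt.div (by fun_prop) (by fun_prop) fun h0 => ?_
  obtain ⟨k, hk⟩ := exists_node_eq_of_exp_eq_one hh hα hx (sub_eq_zero.1 h0).symm
  exact hne k hk

/-- The residue is `i h exp (-s²) / π` at every node. At node 0 for `α = 0` the halved weight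
compensates for the merging of the poles `s` and `-s`, and the difference tends to 0. -/
theorem exists_tendsto_weight_mul_integrand {h α : ℝ} (hh : 0 < h) (hα : α = 0 ∨ α = 1 / 2)
    (k : ℕ) :
    ∃ c, Tendsto (fun z => weight h α k * integrand z (node h α k)
      - Complex.I * h / π * Complex.exp (-(node h α k : ℂ) ^ 2) / (z - node h α k))
      (𝓝[≠] (node h α k : ℂ)) (𝓝 c) := by
  have hpc : (π : ℂ) ≠ 0 := by exact_mod_cast pi_pos.ne'
  by_cases hk : α = 0 ∧ k = 0
  · refine ⟨0, tendsto_const_nhds.congr' ?_⟩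
    obtain ⟨rfl, rfl⟩ := hk
    have h0 : node h 0 0 = 0 := by simp [node]
    rw [h0]
    filter_upwards [self_mem_nhdsWithin] with z hz
    have hz0 : z ≠ 0 := by simpa using hz
    simp [weight, integrand]
    field_simp
    simp
  · set s := node h α k with hs
    have hs0 : 0 < s := by
      rw [hs, node]
      refine mul_pos ?_ hh
      rcases hα with rfl | rfl
      · have : k ≠ 0 := fun h => hk ⟨rfl, h⟩
        have : (0 : ℝ) < k := by exact_mod_cast Nat.pos_of_ne_zero this
        linarith
      · positivity
    have hss : (s : ℂ) + s ≠ 0 := by exact_mod_cast (by positivity : s + s ≠ 0)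
    have hcont : ContinuousAt (fun z : ℂ => Complex.I * h / π * Complex.exp (-(s : ℂ) ^ 2)
        / (z + s)) s := ContinuousAt.div (by fun_prop) (by fun_prop) hss
    refine ⟨_, (hcont.tendsto.mono_left nhdsWithin_le_nhds).congr' ?_⟩
    have hopen : ∀ᶠ z : ℂ in 𝓝[≠] (s : ℂ), z ≠ -s := by
      refine eventually_nhdsWithin_of_eventually_nhds (isOpen_ne.mem_nhds ?_)
      intro h0
      exact hss (by rw [add_eq_zero_iff_eq_neg]; exact h0)
    filter_upwards [self_mem_nhdsWithin, hopen] with z hz hz2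
    rw [weight, if_neg hk, mul_right_comm, two_mul_integrand hz hz2]
    ring

theorem exists_tendsto_rawModApprox_node {h α : ℝ} (hh : 0 < h) (hα : α = 0 ∨ α = 1 / 2)
    {N k : ℕ} (hk : k ≤ N) :
    ∃ c, Tendsto (rawModApprox h α N) (𝓝[≠] (node h α k : ℂ)) (𝓝 c) := by
  have hc : (h : ℂ) ≠ 0 := by exact_mod_cast hh.ne'
  have hpc : (π : ℂ) ≠ 0 := by exact_mod_cast pi_pos.ne'
  obtain ⟨c₁, h1⟩ := exists_tendsto_weight_mul_integrand hh hα k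
  set s := node h α k with hs
  have hs0 : 0 ≤ s := node_nonneg hh (alpha_nonneg hα) k
  have hderiv : HasDerivAt (fun z : ℂ => 1 - Complex.exp (-(2 * Complex.I * (π : ℂ) *
      ((α : ℂ) + z / (h : ℂ))))) (2 * Complex.I * π / h) s := by
    have e1 : HasDerivAt (fun z : ℂ => -(2 * Complex.I * (π : ℂ) * ((α : ℂ) + z / (h : ℂ))))
        (-(2 * Complex.I * (π : ℂ) * (1 / h))) s :=
      ((((hasDerivAt_id (s : ℂ)).div_const (h : ℂ)).const_add (α : ℂ)).const_mul
        (2 * Complex.I * (π : ℂ))).neg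
    refine (e1.cexp.const_sub 1).congr_deriv ?_
    rw [exp_node_eq_one hh hα k]
    ring
  obtain ⟨c₂, h2⟩ := exists_tendsto_div_sub_pole (n := fun z => 2 * Complex.exp (-z ^ 2))
    (D := fun z : ℂ => 1 - Complex.exp (-(2 * Complex.I * (π : ℂ) * ((α : ℂ) + z / (h : ℂ)))))
    (by fun_prop) (by fun_prop) (by rw [exp_node_eq_one hh hα k, sub_self]) hderiv
    (by simp [hh.ne', pi_pos.ne'])
  have h3 : ContinuousAt (fun z => ∑ i ∈ (Finset.range (N + 1)).erase k,
      weight h α i * integrand z (node h α i)) s := by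
    refine tendsto_finsetSum _ fun i hi => ?_
    refine (continuousAt_integrand (sq_sub_sq_ne_zero (by simpa using hs0)
      (node_nonneg hh (alpha_nonneg hα) i) ?_)).const_mul _
    intro h0
    apply (Finset.mem_erase.1 hi).1
    have h5 : node h α k = node h α i := by exact_mod_cast h0
    rw [node, node] at h5
    have h6 := mul_right_cancel₀ hh.ne' h5
    have h7 : (k : ℝ) = i := by linarith
    exact_mod_cast h7.symm
  refine ⟨_, ((h1.add h2).add (h3.tendsto.mono_left nhdsWithin_le_nhds)).congr fun z => ?_⟩
  -- The residue of the correction is the negative of that of the rule, so the two polar parts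
  -- cancel.
  have h4 : 2 * Complex.exp (-(s : ℂ) ^ 2) / (2 * Complex.I * π / h)
      = -(Complex.I * h / π * Complex.exp (-(s : ℂ) ^ 2)) := by
    have hI := Complex.I_ne_zero
    field_simp
    linear_combination Complex.I_sq
  rw [h4, rawModApprox, truncApprox_eq_sum, ← Finset.add_sum_erase _ _
    (Finset.mem_range.2 (Nat.lt_succ_of_le hk)), correction]
  ring

theorem tendsto_rawModApprox {h α : ℝ} (hh : 0 < h) (hα : α = 0 ∨ α = 1 / 2) {N : ℕ} {z : ℂ}
    (hx : 0 ≤ z.re) (hne : ∀ k : ℕ, N + 1 ≤ k → z ≠ node h α k) :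
    Tendsto (rawModApprox h α N) (𝓝[≠] z) (𝓝 (modApprox h α N z)) := by
  refine tendsto_nhds_limUnder ?_
  by_cases hk : ∃ k : ℕ, z = node h α k
  · obtain ⟨k, rfl⟩ := hk
    exact exists_tendsto_rawModApprox_node hh hα (by
      by_contra hcon
      exact hne k (by omega) rfl)
  · push Not at hk
    exact ⟨_, (continuousAt_rawModApprox hh hα N hx hk).tendsto.mono_left nhdsWithin_le_nhds⟩

theorem modApprox_eq_rawModApprox {h α : ℝ} (hh : 0 < h) (hα : α = 0 ∨ α = 1 / 2) {N : ℕ} {z : ℂ}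
    (hx : 0 ≤ z.re) (hy : 0 < z.im) : modApprox h α N z = rawModApprox h α N z :=
  ((continuousAt_rawModApprox hh hα N hx fun _ =>
    ne_ofReal_of_im_pos hy _).tendsto.mono_left nhdsWithin_le_nhds).limUnder_eq

/-! ### Passage to the real axis and conclusion. -/

/-- The dual series is available only for `Im z > 0`. The bounds are closed conditions, so they
survive the limit along `z + i ε`; this path avoids `z`, hence the raw approximation tends to its
regularised value. -/
theorem errorBound_modApprox_of_im_eq_zero {α : ℝ} (hα : α = 0 ∨ α = 1 / 2) {N : ℕ} {z : ℂ}
    (hx : 0 ≤ z.re) (hne : ∀ k : ℕ, N + 1 ≤ k → z ≠ node (step N) α k) (hy : z.im = 0)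
    (hf : ∀ ε : ℝ, 0 < ε → ∀ k : ℕ, N + 1 ≤ k →
      FarFromNode (step N) (z + ε * Complex.I) (node (step N) α k)) :
    ErrorBound N z (modApprox (step N) α N z) := by
  have hpath : Tendsto (fun ε : ℝ => z + ε * Complex.I) (𝓝[>] 0) (𝓝[≠] z) := by
    refine tendsto_nhdsWithin_iff.2 ⟨?_, ?_⟩
    · have : Continuous fun ε : ℝ => z + ε * Complex.I := by fun_prop
      simpa using (this.tendsto 0).mono_left nhdsWithin_le_nhds
    · filter_upwards [self_mem_nhdsWithin] with ε hε
      have : (ε : ℂ) ≠ 0 := by exact_mod_cast (ne_of_gt hε)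
      simpa using this
  have hz' := hpath.mono_right nhdsWithin_le_nhds
  have hw : Tendsto (fun ε : ℝ => ‖w (z + ε * Complex.I)
      - rawModApprox (step N) α N (z + ε * Complex.I)‖) (𝓝[>] 0)
      (𝓝 ‖w z - modApprox (step N) α N z‖) :=
    (((continuous_w.tendsto z).comp hz').sub
      ((tendsto_rawModApprox (step_pos N) hα hx hne).comp hpath)).norm
  have hb : ∀ᶠ ε : ℝ in 𝓝[>] 0, ErrorBound N (z + ε * Complex.I)
      (rawModApprox (step N) α N (z + ε * Complex.I)) := by
    filter_upwards [self_mem_nhdsWithin,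
      Ioo_mem_nhdsGT (div_pos pi_pos (step_pos N))] with ε h1 h2
    have him : (z + ε * Complex.I).im = ε := by simp [hy]
    exact errorBound_rawModApprox_of_im_le hα (by rw [him]; exact h1) (by rw [him]; exact h2.2.le)
      (hf ε h1)
  refine ⟨le_of_tendsto hw (hb.mono fun ε h => h.1), le_of_tendsto (Tendsto.mul ?_ hw)
    (hb.mono fun ε h => h.2)⟩
  exact ((hz'.norm).const_mul _).const_add _

theorem step_le_node {α : ℝ} (hα : 0 ≤ α) {N k : ℕ} (hk : N + 1 ≤ k) :
    step N ≤ node (step N) α k := by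
  have h1 : (1 : ℝ) ≤ k := by exact_mod_cast (by omega : 1 ≤ k)
  rw [node]
  nlinarith [step_pos N]

theorem modApprox_bounds {α : ℝ} (hα : α = 0 ∨ α = 1 / 2) {N : ℕ} {z : ℂ}
    (hz : (z.im ≤ π / step N ∧ z.re ≤ z.im ∧ 0 ≤ z.re) ∨
      (0 ≤ z.im ∧ z.im ≤ z.re ∧
        ∀ k : ℕ, N + 1 ≤ k → step N / 4 ≤ ‖z - ((node (step N) α k : ℝ) : ℂ)‖)) :
    Tendsto (rawModApprox (step N) α N) (𝓝[≠] z) (𝓝 (modApprox (step N) α N z)) ∧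
      ErrorBound N z (modApprox (step N) α N z) := by
  have hh := step_pos N
  have hα0 := alpha_nonneg hα
  have hx : 0 ≤ z.re := by
    rcases hz with h | h
    · exact h.2.2
    · exact h.1.trans h.2.1
  have hy : 0 ≤ z.im := by
    rcases hz with h | h
    · exact h.2.2.trans h.2.1
    · exact h.1
  have hne : ∀ k : ℕ, N + 1 ≤ k → z ≠ node (step N) α k := by
    rintro k hk rfl
    have hs := step_le_node hα0 hk
    rcases hz with h | h
    · have := h.2.1
      simp only [Complex.ofReal_re, Complex.ofReal_im] at this
      linarith
    · have := h.2.2 k hk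
      rw [sub_self, norm_zero] at this
      linarith
  refine ⟨tendsto_rawModApprox hh hα hx hne, ?_⟩
  rcases hy.eq_or_lt with hy0 | hy0
  · refine errorBound_modApprox_of_im_eq_zero hα hx hne hy0.symm fun ε hε k hk => ?_
    rcases hz with h | h
    · refine farFromNode_of_re_le_im hh (by simpa using hx) ?_ (step_le_node hα0 hk)
      have := h.2.1
      simp only [Complex.add_re, Complex.add_im, Complex.re_ofReal_mul, Complex.im_ofReal_mul,
        Complex.I_re, Complex.I_im]
      linarith
    · refine farFromNode_of_dist hh (by simpa using hx) (node_nonneg hh hα0 k)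
        ((h.2.2 k hk).trans ?_)
      rw [add_sub_right_comm]
      exact norm_le_norm_add_I (by simp [← hy0]) hε.le
  · rw [modApprox_eq_rawModApprox hh hα hx hy0]
    rcases hz with h | h
    · exact errorBound_rawModApprox_of_im_le hα hy0 h.1 fun k hk =>
        farFromNode_of_re_le_im hh hx h.2.1 (step_le_node hα0 hk)
    · have hf : ∀ k : ℕ, N + 1 ≤ k → FarFromNode (step N) z (node (step N) α k) := fun k hk =>
        farFromNode_of_dist hh hx (node_nonneg hh hα0 k) (h.2.2 k hk)
      -- Up to height `b` the reflected series controls the error; above it, the unmodified rule is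
      -- accurate and the correction is negligible.
      rcases le_total z.im (π / step N) with hb | hb
      · exact errorBound_rawModApprox_of_im_le hα hy0 hb hf
      · exact errorBound_rawModApprox_of_le_im hα hb h.2.1 hf

end

end Faddeeva

theorem mainTheorem2 (α : ℝ) (hα : α = 0 ∨ α = 1 / 2) (N : ℕ) (h : ℝ) (hh : h = Faddeeva.step N)
    (z : ℂ) :
    (((z.im ≤ Real.pi / h ∧ z.re ≤ z.im ∧ 0 ≤ z.re) ∨
        (0 ≤ z.im ∧ z.im ≤ z.re ∧
          ∀ k : ℕ, N + 1 ≤ k → h / 4 ≤ ‖z - ((Faddeeva.node h α k : ℝ) : ℂ)‖)) →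
      Filter.Tendsto (Faddeeva.rawModApprox h α N) (nhdsWithin z {z}ᶜ)
          (nhds (Faddeeva.modApprox h α N z)) ∧
        Faddeeva.w z ≠ 0 ∧
        ‖Faddeeva.w z - Faddeeva.modApprox h α N z‖ ≤
          Faddeeva.C₁ * Real.exp (-Real.pi * N) ∧
        ‖Faddeeva.w z - Faddeeva.modApprox h α N z‖ / ‖Faddeeva.w z‖ ≤
          Faddeeva.C₂ * √((N : ℝ) + 1) * Real.exp (-Real.pi * N)) ∧
    (0 ≤ z.re ∧ max z.re (Real.pi / h) ≤ z.im →
      Faddeeva.w z ≠ 0 ∧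
        ‖Faddeeva.w z - Faddeeva.truncApprox h α N z‖ ≤
          Faddeeva.C₁ * Real.exp (-Real.pi * N) ∧
        ‖Faddeeva.w z - Faddeeva.truncApprox h α N z‖ / ‖Faddeeva.w z‖ ≤
          Faddeeva.C₂ * √((N : ℝ) + 1) * Real.exp (-Real.pi * N)) := by
  subst hh
  constructor
  · intro hz
    obtain ⟨h1, h2⟩ := Faddeeva.modApprox_bounds hα hz
    refine ⟨h1, h2.bounds ?_ ?_⟩
    · rcases hz with h | h
      · exact h.2.2
      · exact h.1.trans h.2.1
    · rcases hz with h | h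
      · exact h.2.2.trans h.2.1
      · exact h.1
  · rintro ⟨hx, hm⟩
    obtain ⟨hxy, hb⟩ := max_le_iff.1 hm
    obtain ⟨h1, h2⟩ := Faddeeva.errorBound_truncApprox hα hb fun k hk =>
      Faddeeva.farFromNode_of_re_le_im (Faddeeva.step_pos N) hx hxy
        (Faddeeva.step_le_node (Faddeeva.alpha_nonneg hα) hk)
    have he : Faddeeva.ErrorBound N z (Faddeeva.truncApprox (Faddeeva.step N) α N z) :=
      ⟨h1.trans (by gcongr; norm_num), h2.trans (by gcongr; norm_num)⟩
    exact he.bounds hx (hx.trans hxy)
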